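/- Let $k\ge 1$ and let $L_k\subset J^1\mathbb{R}^2$ be the Legendrian sphere that is the cusp-connected sum of $k$ copies of the two-dimensional Legendrian sphere $L_1$, with the following front and polygonal decomposition. The base projection of $L_k$ is a disk with $k$ holes. It contains $k$ disjoint lenses; the $j$-th lens has one tip $v_j$ on the boundary of the $j$-th hole and the other tip $v'_j$ on the outer boundary. The sides of the lens, $B_1^j$ (oriented from $v_j$ to $v'_j$) and $B_2^j$ (oriented from $v'_j$ to $v_j$), and the whole boundary of the base projection are projections of cusp edges. Above the complement $C_1$ of the lenses (an open disk) $L_k$ has two sheets. Across $B_1^j$ they continue as the upper two, and across $B_2^j$ as the lower two, of the four sheets above the lens, while the other two of these four sheets end in a cusp. The two middle sheets above the lens cross along a circle $B_3^j$ inside the lens, with a vertex $A^j$. An edge $B_4^j$ joins $v_j$ to $A^j$. The two-cells are $C_1$, the part $C_2^j$ of each lens outside $B_3^j$ and cut along $B_4^j$, and the disk $C_3^j$ bounded by $B_3^j$. Starting at $v_1$, the boundary of $C_1$ runs (apart from the boundary edges of the base projection, above which there are no sheets) through $B_1^1,B_2^2,B_1^2,B_2^3,B_1^3,\dots,B_2^k,B_1^k,B_2^1$.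 The initial and terminal vertex of each two-cell are both chosen to be $v_1$ for $C_1$, $v_j$ for $C_2^j$ and $A^j$ for $C_3^j$. Then the cellular differential graded algebra of $L_k$ over $\mathbb{Z}/2$, defined by this decomposition and graded by $\mathbb{Z}$, is stable tame isomorphic to the differential graded algebra $(\mathcal{A}_k,\partial)$ that is freely generated, as a unital associative $\mathbb{Z}/2$-algebra, by $2k+1$ generators $x_1,y_1,\dots,x_k,y_k,z$ of degrees $|x_j|=-1$, $|y_j|=|z|=2$, with differentials $$\partial x_j=\partial y_j=0,\qquad \partial z=\sum_{j=1}^k (x_jy_j+y_jx_j).$$ -/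

import Mathlib

open scoped Matrix Topology ContDiff

/-! ### Free graded algebras over `ℤ/2` with a differential -/

/-- A based algebra with differential: the free unital associative `ℤ/2`-algebra on `Gen`, with an
integer degree for each generator and the values of the differential on the generators. -/
structure BasedAlg where
  Gen : Type
  deg : Gen → ℤ
  dGen : Gen → FreeAlgebra (ZMod 2) Gen

namespace BasedAlg

/-- The underlying free algebra. -/
abbrev Alg (X : BasedAlg) : Type := FreeAlgebra (ZMod 2) X.Gen

/-- The generator `g`, as an element of the algebra. -/
abbrev gen (X : BasedAlg) (g : X.Gen) : X.Alg := FreeAlgebra.ι (ZMod 2) g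

/-- The homogeneous elements of degree `n`: the linear combinations of the words of degree `n`. -/
def homogeneous (X : BasedAlg) (n : ℤ) : Submodule (ZMod 2) X.Alg :=
  Submodule.span (ZMod 2)
    {w | ∃ l : List X.Gen, (l.map X.deg).sum = n ∧ w = (l.map X.gen).prod}

/-- The algebra map `a ↦ a + ε ∂a` into the dual numbers of the algebra that encodes the
differential. -/
noncomputable def dualHom (X : BasedAlg) : X.Alg →ₐ[ZMod 2] TrivSqZeroExt X.Alg X.Alg :=
  FreeAlgebra.lift (ZMod 2)
    (fun g => TrivSqZeroExt.inl (X.gen g) + TrivSqZeroExt.inr (X.dGen g))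

/-- The differential: the unique derivation with the prescribed values on the generators
(in characteristic two the signs of the graded Leibniz rule are trivial). -/
noncomputable def diff (X : BasedAlg) : X.Alg →ₗ[ZMod 2] X.Alg :=
  (TrivSqZeroExt.sndHom X.Alg X.Alg).restrictScalars (ZMod 2) ∘ₗ X.dualHom.toLinearMap

theorem fst_dualHom (X : BasedAlg) (a : X.Alg) : (X.dualHom a).fst = a := by
  have h : ((TrivSqZeroExt.fstHom (ZMod 2) X.Alg X.Alg).comp X.dualHom) =
      AlgHom.id (ZMod 2) X.Alg := by
    apply FreeAlgebra.hom_ext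
    funext g
    simp [dualHom]
  exact DFunLike.congr_fun h a

theorem diff_gen (X : BasedAlg) (g : X.Gen) : X.diff (X.gen g) = X.dGen g := by
  simp [diff, dualHom]

theorem diff_one (X : BasedAlg) : X.diff 1 = 0 := by
  simp [diff]

theorem diff_mul (X : BasedAlg) (a b : X.Alg) :
    X.diff (a * b) = X.diff a * b + a * X.diff b := by
  simp [diff, fst_dualHom, add_comm]

/-- The differential makes the algebra a based differential graded algebra: there are finitely many
generators, the differential has degree `-1`, and it squares to zero. -/
def IsDGA (X : BasedAlg) : Prop :=
  Finite X.Gen ∧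
  (∀ (n : ℤ) (a : X.Alg), a ∈ X.homogeneous n → X.diff a ∈ X.homogeneous (n - 1)) ∧
  ∀ a : X.Alg, X.diff (X.diff a) = 0

/-- The generators of a stabilization: the old ones and two new ones, `a` and `b`. -/
inductive StabGen (G : Type) : Type
  | old (g : G)
  | a
  | b

/-- The degree `i` stabilization: `|a| = i`, `|b| = i - 1`, `∂a = b`, `∂b = 0`. -/
noncomputable def stabilize (X : BasedAlg) (i : ℤ) : BasedAlg where
  Gen := StabGen X.Gen
  deg
    | .old g => X.deg g
    | .a => i
    | .b => i - 1
  dGen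
    | .old g => FreeAlgebra.lift (ZMod 2)
        (fun h => FreeAlgebra.ι (ZMod 2) (StabGen.old h)) (X.dGen g)
    | .a => FreeAlgebra.ι (ZMod 2) StabGen.b
    | .b => 0

/-- Successive stabilization in a list of degrees. -/
noncomputable def stabilizeList (X : BasedAlg) (l : List ℤ) : BasedAlg :=
  l.foldl stabilize X

/-- Elementary automorphisms: `g ↦ g + v` for one generator `g`, where `v` lies in the subalgebra
generated by the other generators and has the degree of `g`; the other generators are fixed. -/
def IsElementary (X : BasedAlg) (φ : X.Alg →ₐ[ZMod 2] X.Alg) : Prop :=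
  ∃ (g : X.Gen) (v : X.Alg),
    v ∈ Algebra.adjoin (ZMod 2) (X.gen '' {h | h ≠ g}) ∧
    v ∈ X.homogeneous (X.deg g) ∧
    φ (X.gen g) = X.gen g + v ∧
    ∀ h, h ≠ g → φ (X.gen h) = X.gen h

/-- Tame isomorphism: a composition of elementary automorphisms, followed by the isomorphism induced
by a degree preserving bijection of the generators, that commutes with the differentials. -/
def TameIso (X Y : BasedAlg) : Prop :=
  ∃ φ ∈ Submonoid.closure {φ : X.Alg →ₐ[ZMod 2] X.Alg | X.IsElementary φ},
  ∃ σ : X.Gen ≃ Y.Gen,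
    (∀ g, Y.deg (σ g) = X.deg g) ∧
    ∀ a : X.Alg,
      FreeAlgebra.lift (ZMod 2) (fun g => Y.gen (σ g)) (φ (X.diff a)) =
        Y.diff (FreeAlgebra.lift (ZMod 2) (fun g => Y.gen (σ g)) (φ a))

/-- Stable tame isomorphism. -/
def StableTameIso (X Y : BasedAlg) : Prop :=
  ∃ l l' : List ℤ, TameIso (X.stabilizeList l) (Y.stabilizeList l')

end BasedAlg

/-! ### Combinatorial data of a compatible polygonal decomposition (no swallowtails) -/

/-- The cells of a polygonal decomposition, by dimension. -/
inductive Cell (V E F : Type) : Type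
  | vertex (v : V)
  | edge (e : E)
  | face (f : F)

/-- The dimension of a cell. -/
def Cell.dim {V E F : Type} : Cell V E F → ℤ
  | .vertex _ => 0
  | .edge _ => 1
  | .face _ => 2

/-- How the `n` sheets above a cell end above a vertex on its boundary, above which there are `m`
sheets: `lim i = some p` if the `i`-th sheet has the sheet `p` above the vertex in its closure,
`lim i = none` if it ends in a cusp; `cusp i j` says that the sheets `i` (upper) and `j` (lower)
meet in a cusp above the vertex. -/
structure VertexInc (n m : ℕ) where
  lim : Fin n → Option (Fin m)
  cusp : Fin n → Fin n → Bool

/-- A polygonal decomposition with the sheets of a front above each cell. The sheets above a cell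
are indexed by `Fin (num c)` with non-increasing `z`-coordinate; cusp points are not on sheets. -/
structure FrontData where
  V : Type
  E : Type
  F : Type
  /-- the number of sheets above a cell -/
  num : Cell V E F → ℕ
  /-- `above c p q`: above the cell, sheet `p` has larger `z`-coordinate than sheet `q` -/
  above : (c : Cell V E F) → Fin (num c) → Fin (num c) → Bool
  /-- the Maslov potential -/
  maslov : (c : Cell V E F) → Fin (num c) → ℤ
  /-- initial and terminal vertex of an edge -/
  src : E → V
  tgt : E → V
  srcInc : (e : E) → VertexInc (num (.edge e)) (num (.vertex (src e)))
  tgtInc : (e : E) → VertexInc (num (.edge e)) (num (.vertex (tgt e)))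
  /-- the chosen initial and terminal vertex `v₀`, `v₁` on the boundary of a face -/
  init : F → V
  term : F → V
  initInc : (f : F) → VertexInc (num (.face f)) (num (.vertex (init f)))
  termInc : (f : F) → VertexInc (num (.face f)) (num (.vertex (term f)))
  /-- The edges along the counterclockwise and the clockwise path from `v₀` to `v₁`; each comes with
  `true` if it is traversed in its own direction, and with the sheet above it, if any, in the
  closure of each sheet above the face. -/
  posPath : (f : F) →
    List ((e : E) × Bool × (Fin (num (.face f)) → Option (Fin (num (.edge e)))))
  negPath : (f : F) →
    List ((e : E) × Bool × (Fin (num (.face f)) → Option (Fin (num (.edge e)))))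

namespace FrontData

/-- One generator for each cell and each pair of sheets above it, the first above the second. -/
structure Gen (D : FrontData) : Type where
  cell : Cell D.V D.E D.F
  p : Fin (D.num cell)
  q : Fin (D.num cell)
  isAbove : D.above cell p q = true

/-- The free algebra on the generators. -/
abbrev Alg (D : FrontData) : Type := FreeAlgebra (ZMod 2) D.Gen

/-- The generator of a pair of sheets if the first is above the second, and `0` otherwise. -/
noncomputable def entry (D : FrontData) (c : Cell D.V D.E D.F) (p q : Fin (D.num c)) : D.Alg :=
  if h : D.above c p q = true then FreeAlgebra.ι (ZMod 2) ⟨c, p, q, h⟩ else 0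

/-- The matrix of the generators of a cell. -/
noncomputable def mat (D : FrontData) (c : Cell D.V D.E D.F) :
    Matrix (Fin (D.num c)) (Fin (D.num c)) D.Alg :=
  Matrix.of (D.entry c)

/-- The generators of a boundary vertex, placed into a matrix indexed by the sheets above a larger
cell, with an entry `1` for each pair of sheets that meet in a cusp above the vertex. -/
noncomputable def vertexMat (D : FrontData) (v : D.V) {n : ℕ}
    (I : VertexInc n (D.num (.vertex v))) : Matrix (Fin n) (Fin n) D.Alg :=
  Matrix.of fun i j =>
    match I.lim i, I.lim j with
    | some p, some q => D.entry (.vertex v) p q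
    | _, _ => if I.cusp i j = true then 1 else 0

/-- The generators of a boundary edge, placed into a matrix indexed by the sheets above a face. -/
noncomputable def edgeMat (D : FrontData) (e : D.E) {n : ℕ}
    (lim : Fin n → Option (Fin (D.num (.edge e)))) : Matrix (Fin n) (Fin n) D.Alg :=
  Matrix.of fun i j =>
    match lim i, lim j with
    | some p, some q => D.entry (.edge e) p q
    | _, _ => 0

/-- The factor `(I + B)^{±1}` of a boundary edge; as `B` is strictly upper triangular of size `n`,
the inverse of `I + B` is `I + B + ⋯ + B ^ (n - 1)`. -/
noncomputable def stepMat (D : FrontData) {n : ℕ}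
    (s : (e : D.E) × Bool × (Fin n → Option (Fin (D.num (.edge e))))) :
    Matrix (Fin n) (Fin n) D.Alg :=
  if s.2.1 = true then 1 + D.edgeMat s.1 s.2.2
  else ∑ i ∈ Finset.range n, D.edgeMat s.1 s.2.2 ^ i

/-- The product `(I + B_j)^{η_j} ⋯ (I + B_1)^{η_1}` along a path of edges. -/
noncomputable def pathMat (D : FrontData) {n : ℕ}
    (l : List ((e : D.E) × Bool × (Fin n → Option (Fin (D.num (.edge e)))))) :
    Matrix (Fin n) (Fin n) D.Alg :=
  l.foldl (fun M s => D.stepMat s * M) 1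

/-- The matrix `∂A`, `∂B` or `∂C` of the differentials of the generators of a cell. -/
noncomputable def dMat (D : FrontData) : (c : Cell D.V D.E D.F) →
    Matrix (Fin (D.num c)) (Fin (D.num c)) D.Alg
  | .vertex v => D.mat (.vertex v) * D.mat (.vertex v)
  | .edge e =>
      D.vertexMat (D.tgt e) (D.tgtInc e) * (1 + D.mat (.edge e)) +
        (1 + D.mat (.edge e)) * D.vertexMat (D.src e) (D.srcInc e)
  | .face f =>
      D.vertexMat (D.term f) (D.termInc f) * D.mat (.face f) +
        D.mat (.face f) * D.vertexMat (D.init f) (D.initInc f) +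
        D.pathMat (D.posPath f) + D.pathMat (D.negPath f)

/-- The cellular differential graded algebra. A generator of a cell of dimension `d` and sheets
`p`, `q` has degree `μ(p) - μ(q) + d - 1`. -/
noncomputable def cellularDGA (D : FrontData) : BasedAlg where
  Gen := D.Gen
  deg g := D.maslov g.cell g.p - D.maslov g.cell g.q + g.cell.dim - 1
  dGen g := D.dMat g.cell g.p g.q

end FrontData

/-! ### Legendrian surfaces in the one-jet space of the plane -/

/-- The plane. -/
abbrev Plane : Type := EuclideanSpace ℝ (Fin 2)

/-- The one-jet space of the plane, with points `(x, y, z)` and contact form `dz - ∑ yᵢ dxᵢ`. -/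
abbrev Jet : Type := Plane × Plane × ℝ

/-- The front projection. -/
def Jet.front (q : Jet) : Plane × ℝ := (q.1, q.2.2)

/-- Embedded Legendrian surfaces: locally the image of a smooth embedding of an open subset of the
plane, on which the contact form vanishes. -/
def IsLegendrianSurface (L : Set Jet) : Prop :=
  ∀ p ∈ L, ∃ (U : Set Plane) (W : Set Jet) (φ : Plane → Jet),
    IsOpen U ∧ IsOpen W ∧ p ∈ W ∧ φ '' U = L ∩ W ∧
    ContDiffOn ℝ ∞ φ U ∧ Topology.IsEmbedding (U.domRestrict φ) ∧
    ∀ u ∈ U, Function.Injective (fderiv ℝ φ u) ∧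
      ∀ w : Plane, (fderiv ℝ φ u w).2.2 = inner ℝ (φ u).2.1 (fderiv ℝ φ u w).1

/-- Near `p`, the front of `L` is the graph of a smooth function. -/
def IsGraphPoint (L : Set Jet) (p : Jet) : Prop :=
  ∃ (W : Set Jet) (U : Set Plane) (f : Plane → ℝ),
    IsOpen W ∧ p ∈ W ∧ IsOpen U ∧ p.1 ∈ U ∧ ContDiffOn ℝ ∞ f U ∧
    Jet.front '' (L ∩ W) = {r | r.1 ∈ U ∧ r.2 = f r.1}

/-- The standard cusp edge: a semicubical cusp times a line. -/
def standardCuspEdge : Set (Plane × ℝ) := {r | ∃ s : ℝ, r.1 0 = s ^ 2 ∧ r.2 = s ^ 3}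

/-- Near `p`, the front of `L` is diffeomorphic to the standard cusp edge, with `p` on the edge. -/
def IsCuspPoint (L : Set Jet) (p : Jet) : Prop :=
  ∃ (W : Set Jet) (Φ : OpenPartialHomeomorph (Plane × ℝ) (Plane × ℝ)),
    IsOpen W ∧ p ∈ W ∧ p.front ∈ Φ.source ∧
    ContDiffOn ℝ ∞ Φ Φ.source ∧ ContDiffOn ℝ ∞ Φ.symm Φ.target ∧
    Jet.front '' (L ∩ W) = {r | r ∈ Φ.source ∧ Φ r ∈ standardCuspEdge} ∧
    (Φ p.front).1 0 = 0 ∧ (Φ p.front).2 = 0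

/-- Maslov potentials: locally constant away from the cusp edges, and larger by one on the upper
sheet of a cusp edge than on the lower one. -/
def IsMaslovPotential (L : Set Jet) (μ : Jet → ℤ) : Prop :=
  (∀ q ∈ L, ¬ IsCuspPoint L q → ∀ᶠ r in 𝓝[L] q, μ r = μ q) ∧
  ∀ q ∈ L, IsCuspPoint L q → ∀ᶠ r in 𝓝[L ×ˢ L] (q, q),
    ¬ IsCuspPoint L r.1 → ¬ IsCuspPoint L r.2 → r.1.1 = r.2.1 → r.2.2.2 < r.1.2.2 →
      μ r.1 = μ r.2 + 1

/-- The vertical order of points above one base point is the one recorded by `above`. -/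
def OrderMatches {n : ℕ} (above : Fin n → Fin n → Bool) (P : Fin n → Jet) : Prop :=
  ∀ p q, (above p q = true ↔ (P q).2.2 < (P p).2.2) ∧ (p ≤ q → (P q).2.2 ≤ (P p).2.2)

/-- The end points `P` above a vertex of the sheets above a cell match the recorded incidence with
the sheets `Q` above the vertex. -/
def VertexMatches (L : Set Jet) {n m : ℕ} (I : VertexInc n m) (P : Fin n → Jet)
    (Q : Fin m → Jet) : Prop :=
  (∀ i p, I.lim i = some p → P i = Q p) ∧
  (∀ i, I.lim i = none → IsCuspPoint L (P i)) ∧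
  ∀ i j, I.cusp i j = true ↔ i < j ∧ I.lim i = none ∧ I.lim j = none ∧ P i = P j

/-- The point of the unit circle at angle `2πt`. -/
noncomputable def circlePt (t : ℝ) : ℂ := Complex.exp (2 * Real.pi * t * Complex.I)

/-- A decomposition of the base projection of a Legendrian surface `L` without swallowtail points
into polygons, compatible with `L`, whose sheets and incidences are those recorded in `D`.
Sheets are given as the lifts to `L` of the characteristic maps of the cells. -/
structure CompatibleDecomposition (D : FrontData) (L : Set Jet) where
  isCompact : IsCompact L
  legendrian : IsLegendrianSurface L
  noSwallowtail : ∀ p ∈ L, IsGraphPoint L p ∨ IsCuspPoint L p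
  /-- the vertices and the characteristic maps of the edges and of the faces -/
  pos : D.V → Plane
  arc : D.E → ℝ → Plane
  disk : D.F → ℂ → Plane
  arc_smooth : ∀ e, ContDiffOn ℝ ∞ (arc e) (Set.Icc 0 1)
  arc_inj : ∀ e, Set.InjOn (arc e) (Set.Ioo 0 1)
  arc_src : ∀ e, arc e 0 = pos (D.src e)
  arc_tgt : ∀ e, arc e 1 = pos (D.tgt e)
  disk_cont : ∀ f, ContinuousOn (disk f) (Metric.closedBall 0 1)
  disk_inj : ∀ f, Set.InjOn (disk f) (Metric.ball 0 1)
  /-- the open cells -/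
  cell : Cell D.V D.E D.F → Set Plane
  cell_vertex : ∀ v, cell (.vertex v) = {pos v}
  cell_edge : ∀ e, cell (.edge e) = arc e '' Set.Ioo 0 1
  cell_face : ∀ f, cell (.face f) = disk f '' Metric.ball 0 1
  cell_disjoint : Pairwise (Function.onFun Disjoint cell)
  cell_cover : ⋃ c, cell c = Prod.fst '' L
  /-- the sheets above the cells -/
  sheetV : (v : D.V) → Fin (D.num (.vertex v)) → Jet
  sheetE : (e : D.E) → Fin (D.num (.edge e)) → ℝ → Jet
  sheetF : (f : D.F) → Fin (D.num (.face f)) → ℂ → Jet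
  sheetE_cont : ∀ e p, ContinuousOn (sheetE e p) (Set.Icc 0 1)
  sheetF_cont : ∀ f p, ContinuousOn (sheetF f p) (Metric.closedBall 0 1)
  sheetV_base : ∀ v p, (sheetV v p).1 = pos v
  sheetE_base : ∀ e p, ∀ t ∈ Set.Icc (0 : ℝ) 1, (sheetE e p t).1 = arc e t
  sheetF_base : ∀ f p, ∀ w ∈ Metric.closedBall (0 : ℂ) 1, (sheetF f p w).1 = disk f w
  sheetV_inj : ∀ v, Function.Injective (sheetV v)
  sheetE_inj : ∀ e, ∀ t ∈ Set.Ioo (0 : ℝ) 1, Function.Injective (fun p => sheetE e p t)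
  sheetF_inj : ∀ f, ∀ w ∈ Metric.ball (0 : ℂ) 1, Function.Injective (fun p => sheetF f p w)
  /-- the sheets consist of the points of `L` that do not lie on cusp edges, and there are no cusp
  points above the faces -/
  sheetV_range : ∀ v, Set.range (sheetV v) = {q ∈ L | q.1 = pos v ∧ ¬ IsCuspPoint L q}
  sheetE_range : ∀ e, ∀ t ∈ Set.Ioo (0 : ℝ) 1,
    Set.range (fun p => sheetE e p t) = {q ∈ L | q.1 = arc e t ∧ ¬ IsCuspPoint L q}
  sheetF_range : ∀ f, ∀ w ∈ Metric.ball (0 : ℂ) 1,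
    Set.range (fun p => sheetF f p w) = {q ∈ L | q.1 = disk f w}
  face_noCusp : ∀ f, ∀ q ∈ L, q.1 ∈ cell (.face f) → ¬ IsCuspPoint L q
  /-- above a face no two sheets cross -/
  face_noCrossing : ∀ f p q, D.above (.face f) p q = true ↔ p < q
  /-- the vertical order of the sheets -/
  orderV : ∀ v, OrderMatches (D.above (.vertex v)) (sheetV v)
  orderE : ∀ e, ∀ t ∈ Set.Ioo (0 : ℝ) 1,
    OrderMatches (D.above (.edge e)) (fun p => sheetE e p t)
  orderF : ∀ f, ∀ w ∈ Metric.ball (0 : ℂ) 1,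
    OrderMatches (D.above (.face f)) (fun p => sheetF f p w)
  /-- the behaviour of the sheets of an edge at its end points -/
  src_matches : ∀ e,
    VertexMatches L (D.srcInc e) (fun p => sheetE e p 0) (sheetV (D.src e))
  tgt_matches : ∀ e,
    VertexMatches L (D.tgtInc e) (fun p => sheetE e p 1) (sheetV (D.tgt e))
  /-- The subdivisions of the two boundary paths of a face. Angles are in full turns; `v₀` has
  angle `0`, and `v₁` has the angle at which the counterclockwise path ends. -/
  posAngle : D.F → ℕ → ℝ
  negAngle : D.F → ℕ → ℝ
  posAngle_zero : ∀ f, posAngle f 0 = 0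
  negAngle_zero : ∀ f, negAngle f 0 = 0
  posAngle_lt : ∀ f i, i < (D.posPath f).length → posAngle f i < posAngle f (i + 1)
  negAngle_lt : ∀ f i, i < (D.negPath f).length → negAngle f (i + 1) < negAngle f i
  angle_end : ∀ f,
    negAngle f (D.negPath f).length = posAngle f (D.posPath f).length - 1
  disk_init : ∀ f, disk f (circlePt 0) = pos (D.init f)
  disk_term : ∀ f, disk f (circlePt (posAngle f (D.posPath f).length)) = pos (D.term f)
  init_matches : ∀ f,
    VertexMatches L (D.initInc f) (fun p => sheetF f p (circlePt 0)) (sheetV (D.init f))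
  term_matches : ∀ f,
    VertexMatches L (D.termInc f)
      (fun p => sheetF f p (circlePt (posAngle f (D.posPath f).length))) (sheetV (D.term f))
  /-- Each interval of the subdivision is mapped homeomorphically to the recorded edge, in the
  recorded direction, with the recorded incidence of sheets. -/
  step_matches : ∀ (f : D.F) (α β : ℝ)
    (s : (e : D.E) × Bool × (Fin (D.num (.face f)) → Option (Fin (D.num (.edge e))))),
    (∃ i, (D.posPath f)[i]? = some s ∧ α = posAngle f i ∧ β = posAngle f (i + 1)) ∨
    (∃ i, (D.negPath f)[i]? = some s ∧ α = negAngle f i ∧ β = negAngle f (i + 1)) →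
    ∃ σ : ℝ → ℝ, ContinuousOn σ (Set.uIcc α β) ∧ Set.InjOn σ (Set.uIcc α β) ∧
      σ α = (if s.2.1 = true then 0 else 1) ∧ σ β = (if s.2.1 = true then 1 else 0) ∧
      (∀ t ∈ Set.uIcc α β, disk f (circlePt t) = arc s.1 (σ t)) ∧
      ∀ t ∈ Set.Ioo (min α β) (max α β), ∀ i,
        (∀ p, s.2.2 i = some p → sheetF f i (circlePt t) = sheetE s.1 p (σ t)) ∧
        (s.2.2 i = none → IsCuspPoint L (sheetF f i (circlePt t)))
  /-- a Maslov potential of `L` with the recorded values on the sheets -/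
  potential : Jet → ℤ
  isMaslov : IsMaslovPotential L potential
  maslovV : ∀ v p, D.maslov (.vertex v) p = potential (sheetV v p)
  maslovE : ∀ e p, ∀ t ∈ Set.Ioo (0 : ℝ) 1,
    D.maslov (.edge e) p = potential (sheetE e p t)
  maslovF : ∀ f p, ∀ w ∈ Metric.ball (0 : ℂ) 1,
    D.maslov (.face f) p = potential (sheetF f p w)

/-- The cellular differential graded algebra of a Legendrian surface with a compatible
decomposition. -/
noncomputable def CompatibleDecomposition.cellularDGA {D : FrontData} {L : Set Jet}
    (_E : CompatibleDecomposition D L) : BasedAlg :=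
  D.cellularDGA

/-! ### The Legendrian spheres `L_k`

The base projection of `L_k` is a disk with `k` holes. In it there are `k` disjoint lenses, the
`j`-th with one tip `tip j` on the boundary of the `j`-th hole and the other tip `outerTip j` on the
outer boundary; the sides `B1 j` and `B2 j` of the lens, the boundaries `hole j` of the holes and
the pieces `outer j` of the outer boundary are projections of cusp edges. Above the complement `C1`
of the lenses, which is a disk, there are two sheets. They continue above the lens as the upper two
of four sheets across `B1 j`, and as the lower two across `B2 j`, where the other two sheets end in
a cusp. Above the circle `B3 j` inside the lens, the two middle sheets cross. -/

namespace Lk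

/-- The vertices: the tips of the lenses and a point `A j` on each crossing circle. -/
inductive Vert (k : ℕ) : Type
  | tip (j : Fin k)
  | outerTip (j : Fin k)
  | A (j : Fin k)

/-- The edges: `B1`, `B2` are the sides of the lenses, `B3` the crossing circles, `B4` joins the tip
of a lens to the crossing circle, `hole` and `outer` form the boundary of the base projection. -/
inductive Edge (k : ℕ) : Type
  | B1 (j : Fin k)
  | B2 (j : Fin k)
  | B3 (j : Fin k)
  | B4 (j : Fin k)
  | hole (j : Fin k)
  | outer (j : Fin k)

/-- The faces: the complement `C1` of the lenses, the part `C2` of each lens outside the crossing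
circle, cut along `B4`, and the disk `C3` inside the crossing circle. -/
inductive Face (k : ℕ) : Type
  | C1
  | C2 (j : Fin k)
  | C3 (j : Fin k)

/-- The number of sheets. -/
def num (k : ℕ) : Cell (Vert k) (Edge k) (Face k) → ℕ
  | .vertex (.tip _) => 0
  | .vertex (.outerTip _) => 0
  | .vertex (.A _) => 4
  | .edge (.B1 _) => 2
  | .edge (.B2 _) => 2
  | .edge (.B3 _) => 4
  | .edge (.B4 _) => 4
  | .edge (.hole _) => 0
  | .edge (.outer _) => 0
  | .face .C1 => 2
  | .face (.C2 _) => 4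
  | .face (.C3 _) => 4

/-- The vertical order: above `A` and `B3` the two middle sheets coincide in the front. -/
def above (k : ℕ) : (c : Cell (Vert k) (Edge k) (Face k)) →
    Fin (num k c) → Fin (num k c) → Bool
  | .vertex (.A _), p, q => decide (p.val < q.val ∧ ¬ (p.val = 1 ∧ q.val = 2))
  | .edge (.B3 _), p, q => decide (p.val < q.val ∧ ¬ (p.val = 1 ∧ q.val = 2))
  | _, p, q => decide (p.val < q.val)

/-- The Maslov potential. Above `A` and `B3` the sheets are numbered as above `C2`; above `C3` the
two middle sheets are in the opposite order. -/
def maslov (k : ℕ) : (c : Cell (Vert k) (Edge k) (Face k)) → Fin (num k c) → ℤ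
  | .vertex (.tip _) => Fin.elim0
  | .vertex (.outerTip _) => Fin.elim0
  | .vertex (.A _) => ![1, 0, 1, 0]
  | .edge (.B1 _) => ![1, 0]
  | .edge (.B2 _) => ![1, 0]
  | .edge (.B3 _) => ![1, 0, 1, 0]
  | .edge (.B4 _) => ![1, 0, 1, 0]
  | .edge (.hole _) => Fin.elim0
  | .edge (.outer _) => Fin.elim0
  | .face .C1 => ![1, 0]
  | .face (.C2 _) => ![1, 0, 1, 0]
  | .face (.C3 _) => ![1, 1, 0, 0]

/-- Initial vertices of the edges. -/
def src (k : ℕ) : Edge k → Vert k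
  | .B1 j => .tip j
  | .B2 j => .outerTip j
  | .B3 j => .A j
  | .B4 j => .tip j
  | .hole j => .tip j
  | .outer j => .outerTip j

/-- Terminal vertices of the edges; the outer edges are numbered cyclically. -/
def tgt (k : ℕ) [NeZero k] : Edge k → Vert k
  | .B1 j => .outerTip j
  | .B2 j => .tip j
  | .B3 j => .A j
  | .B4 j => .A j
  | .hole j => .tip j
  | .outer j => .outerTip (j + 1)

/-- All sheets end in cusps, the first with the second, the third with the fourth, and so on. -/
def allCusps (n m : ℕ) : VertexInc n m where
  lim _ := none
  cusp i j := decide (i.val % 2 = 0 ∧ j.val = i.val + 1)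

/-- The sheets continue with the same numbering. -/
def sameSheets (n : ℕ) : VertexInc n n where
  lim := some
  cusp _ _ := false

/-- The sheets continue, and the two middle ones have their numbers exchanged. -/
def swapSheets : VertexInc 4 4 where
  lim := ![some 0, some 2, some 1, some 3]
  cusp _ _ := false

/-- Sheets of the edges at their initial vertices. -/
def srcInc (k : ℕ) : (e : Edge k) → VertexInc (num k (.edge e)) (num k (.vertex (src k e)))
  | .B1 _ => allCusps 2 0
  | .B2 _ => allCusps 2 0
  | .B3 _ => sameSheets 4
  | .B4 _ => allCusps 4 0
  | .hole _ => allCusps 0 0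
  | .outer _ => allCusps 0 0

/-- Sheets of the edges at their terminal vertices. -/
def tgtInc (k : ℕ) [NeZero k] :
    (e : Edge k) → VertexInc (num k (.edge e)) (num k (.vertex (tgt k e)))
  | .B1 _ => allCusps 2 0
  | .B2 _ => allCusps 2 0
  | .B3 _ => sameSheets 4
  | .B4 _ => sameSheets 4
  | .hole _ => allCusps 0 0
  | .outer _ => allCusps 0 0

/-- The vertex on the boundary of each face that is both initial and terminal. -/
def base (k : ℕ) [NeZero k] : Face k → Vert k
  | .C1 => .tip 0
  | .C2 j => .tip j
  | .C3 j => .A j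

/-- Sheets of the faces at these vertices. -/
def baseInc (k : ℕ) [NeZero k] :
    (f : Face k) → VertexInc (num k (.face f)) (num k (.vertex (base k f)))
  | .C1 => allCusps 2 0
  | .C2 _ => allCusps 4 0
  | .C3 _ => swapSheets

/-- The boundary of the faces, starting at the chosen vertex. -/
def boundary (k : ℕ) [NeZero k] : (f : Face k) →
    List ((e : Edge k) × Bool × (Fin (num k (.face f)) → Option (Fin (num k (.edge e)))))
  | .C1 =>
      [⟨.B1 0, true, fun i : Fin 2 => some i⟩, ⟨.outer 0, true, fun _ => none⟩] ++
      (List.finRange k).tail.flatMap (fun j =>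
        [⟨.B2 j, true, fun i : Fin 2 => some i⟩, ⟨.hole j, true, fun _ => none⟩,
          ⟨.B1 j, true, fun i : Fin 2 => some i⟩, ⟨.outer j, true, fun _ => none⟩]) ++
      [⟨.B2 0, true, fun i : Fin 2 => some i⟩, ⟨.hole 0, true, fun _ => none⟩]
  | .C2 j =>
      [⟨.B1 j, true, (![some 0, some 1, none, none] : Fin 4 → Option (Fin 2))⟩,
        ⟨.B2 j, true, (![none, none, some 0, some 1] : Fin 4 → Option (Fin 2))⟩,
        ⟨.B4 j, true, fun i : Fin 4 => some i⟩,
        ⟨.B3 j, true, fun i : Fin 4 => some i⟩,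
        ⟨.B4 j, false, fun i : Fin 4 => some i⟩]
  | .C3 j => [⟨.B3 j, true, (![some 0, some 2, some 1, some 3] : Fin 4 → Option (Fin 4))⟩]

/-- The decomposition and the sheets of the Legendrian sphere `L_k`. -/
def front (k : ℕ) [NeZero k] : FrontData where
  V := Vert k
  E := Edge k
  F := Face k
  num := num k
  above := above k
  maslov := maslov k
  src := src k
  tgt := tgt k
  srcInc := srcInc k
  tgtInc := tgtInc k
  init := base k
  term := base k
  initInc := baseInc k
  termInc := baseInc k
  posPath := boundary k
  negPath _ := []

/-- The generators of the small model. -/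
inductive ModelGen (k : ℕ) : Type
  | x (j : Fin k)
  | y (j : Fin k)
  | z

/-- The small model: `|x_j| = -1`, `|y_j| = |z| = 2`, `∂x_j = ∂y_j = 0` and
`∂z = ∑ⱼ (x_j y_j + y_j x_j)`. -/
noncomputable def model (k : ℕ) : BasedAlg where
  Gen := ModelGen k
  deg
    | .x _ => -1
    | .y _ => 2
    | .z => 2
  dGen
    | .x _ => 0
    | .y _ => 0
    | .z => ∑ j : Fin k,
        (FreeAlgebra.ι (ZMod 2) (ModelGen.x j) * FreeAlgebra.ι (ZMod 2) (ModelGen.y j) +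
          FreeAlgebra.ι (ZMod 2) (ModelGen.y j) * FreeAlgebra.ι (ZMod 2) (ModelGen.x j))

end Lk

/-! All but 2k + 1 generators of the cellular algebra fall into cancelling pairs, fourteen for each
lens: ∂ top = bot + remainder, where the remainder involves only generators of lower filtration than
bot. The surviving differential can be read off by setting ∂ top = 0. At the tip of a lens all
sheets end in cusps, and ∂ of the edge `B4` says that the matrix of the vertex A is the cusp matrix
conjugated by 1 + `B4`. Up to cancellation this gives A01 = A23 = 1 and A02 = A13 = x, with x the
generator of the middle sheets above `B4`; x is a cycle because the middle sheets cross above A, so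
that A12 = 0. Above `C3` the middle sheets are exchanged. Hence the middle generator y of `C3` is a
cycle too, and two other entries of ∂`C3` give B01 = A02 y = xy and B23 = y A13 = yx for the circle
`B3`. The face `C2` identifies the generators of the two sides of the lens with B01 and B23. The
boundary of `C1` adds up the generators of all sides, whence ∂z = ∑ (xy + yx).

To turn this into a tame isomorphism, `exists_tame_of_triangular` solves φ(g) = g + φ(w g) for
triangular w. With w(bot) = remainder, characteristic two gives φ(∂ top) = bot, as in a
stabilization; a correction of z absorbs the remaining exact terms. The differentials come from
matrix computations (`sorted_relabelIso`), and `sorted_tameIso` checks on generators that φ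
intertwines them with those of the stabilized model. `exists_relabelIso_stabilizeList` replaces the
simultaneous stabilization by successive ones. That ∂² = 0 and that ∂ has degree -1 on the cellular
algebra is inherited from the model by `TameIso.isDGA`. -/

namespace BasedAlg

/-! ### Homogeneous elements -/

theorem gen_mem_homogeneous (X : BasedAlg) (g : X.Gen) : X.gen g ∈ X.homogeneous (X.deg g) :=
  Submodule.subset_span ⟨[g], by simp, by simp⟩

theorem one_mem_homogeneous (X : BasedAlg) : (1 : X.Alg) ∈ X.homogeneous 0 :=
  Submodule.subset_span ⟨[], by simp, by simp⟩

theorem mul_mem_homogeneous (X : BasedAlg) {m n : ℤ} {a b : X.Alg} (ha : a ∈ X.homogeneous m)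
    (hb : b ∈ X.homogeneous n) : a * b ∈ X.homogeneous (m + n) := by
  have h := Submodule.mul_mem_mul ha hb
  rw [homogeneous, homogeneous, Submodule.span_mul_span] at h
  refine Submodule.span_mono ?_ h
  rintro _ ⟨_, ⟨l, hl, rfl⟩, _, ⟨l', hl', rfl⟩, rfl⟩
  exact ⟨l ++ l', by simp [hl, hl'], by simp⟩

theorem map_mem_homogeneous {X Y : BasedAlg} (f : X.Alg →ₐ[ZMod 2] Y.Alg)
    (hf : ∀ g, f (X.gen g) ∈ Y.homogeneous (X.deg g)) {n : ℤ} {a : X.Alg}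
    (ha : a ∈ X.homogeneous n) : f a ∈ Y.homogeneous n := by
  refine Submodule.span_induction (p := fun a _ => f a ∈ Y.homogeneous n) ?_ ?_ ?_ ?_ ha
  · rintro _ ⟨l, rfl, rfl⟩
    clear ha
    induction l with
    | nil => simpa using Y.one_mem_homogeneous
    | cons g l ih => simpa using Y.mul_mem_homogeneous (hf g) ih
  · simp
  · intro a b _ _ ha hb
    simpa using add_mem ha hb
  · intro c a _ ha
    simpa using Submodule.smul_mem _ c ha

/-! ### Differentials and their compatibility with algebra maps -/

theorem diff_algebraMap (X : BasedAlg) (r : ZMod 2) : X.diff (algebraMap _ _ r) = 0 := by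
  rw [Algebra.algebraMap_eq_smul_one, map_smul, diff_one, smul_zero]

/-- Both sides are derivations along `f`, so agreement on generators is enough. -/
theorem map_diff {X Y : BasedAlg} (f : X.Alg →ₐ[ZMod 2] Y.Alg)
    (hf : ∀ g, f (X.dGen g) = Y.diff (f (X.gen g))) (a : X.Alg) :
    f (X.diff a) = Y.diff (f a) := by
  induction a using FreeAlgebra.induction with
  | grade0 r => rw [diff_algebraMap, AlgHom.commutes, diff_algebraMap, map_zero]
  | grade1 g => exact (congrArg f (X.diff_gen g)).trans (hf g)
  | mul a b ha hb => simp only [diff_mul, map_add, map_mul, ha, hb]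
  | add a b ha hb => simp only [map_add, ha, hb]

theorem diff_mem_homogeneous (X : BasedAlg)
    (hX : ∀ g, X.dGen g ∈ X.homogeneous (X.deg g - 1)) {n : ℤ} {a : X.Alg}
    (ha : a ∈ X.homogeneous n) : X.diff a ∈ X.homogeneous (n - 1) := by
  refine Submodule.span_induction (p := fun a _ => X.diff a ∈ X.homogeneous (n - 1))
    ?_ ?_ ?_ ?_ ha
  · rintro _ ⟨l, rfl, rfl⟩
    clear ha
    induction l with
    | nil => simp [diff_one]
    | cons g l ih =>
      simp only [List.map_cons, List.prod_cons, List.sum_cons, diff_mul, diff_gen]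
      refine add_mem ?_ ?_
      · have := X.mul_mem_homogeneous (hX g)
          (Submodule.subset_span ⟨l, rfl, rfl⟩ :
            (l.map X.gen).prod ∈ X.homogeneous (l.map X.deg).sum)
        convert this using 2
        ring
      · convert X.mul_mem_homogeneous (X.gen_mem_homogeneous g) ih using 2
        ring
  · simp
  · intro a b _ _ ha hb
    simpa using add_mem ha hb
  · intro c a _ ha
    simpa using Submodule.smul_mem _ c ha

theorem diff_diff (X : BasedAlg) (hX : ∀ g, X.diff (X.dGen g) = 0) (a : X.Alg) :
    X.diff (X.diff a) = 0 := by
  induction a using FreeAlgebra.induction with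
  | grade0 r => rw [diff_algebraMap, map_zero]
  | grade1 g => exact (congrArg X.diff (X.diff_gen g)).trans (hX g)
  | mul a b ha hb =>
    simp only [diff_mul, map_add, ha, hb, zero_mul, mul_zero, add_zero, zero_add]
    -- What is left is the mixed term ∂a ∂b, which occurs twice.
    exact CharTwo.add_self_eq_zero _
  | add a b ha hb => rw [map_add, map_add, ha, hb, add_zero]

theorem isDGA_of_gen (X : BasedAlg) [Finite X.Gen]
    (hdeg : ∀ g, X.dGen g ∈ X.homogeneous (X.deg g - 1))
    (hsq : ∀ g, X.diff (X.dGen g) = 0) : X.IsDGA :=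
  ⟨inferInstance, fun _ _ => X.diff_mem_homogeneous hdeg, X.diff_diff hsq⟩

/-! ### Elementary and triangular automorphisms -/

theorem map_eq_self_of_mem_adjoin {X : BasedAlg} (φ : X.Alg →ₐ[ZMod 2] X.Alg) {S : Set X.Gen}
    (hφ : ∀ g ∈ S, φ (X.gen g) = X.gen g) {v : X.Alg}
    (hv : v ∈ Algebra.adjoin (ZMod 2) (X.gen '' S)) : φ v = v := by
  have h : Algebra.adjoin (ZMod 2) (X.gen '' S) ≤ AlgHom.equalizer φ (AlgHom.id _ _) := by
    refine Algebra.adjoin_le ?_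
    rintro _ ⟨g, hg, rfl⟩
    exact hφ g hg
  exact h hv

/-- The summand `v` avoids `g` and is therefore fixed, so a second application adds `v` again, and
2v = 0. -/
theorem IsElementary.comp_self {X : BasedAlg} {φ : X.Alg →ₐ[ZMod 2] X.Alg}
    (h : X.IsElementary φ) (a : X.Alg) : φ (φ a) = a := by
  obtain ⟨g, v, hv, -, hg, hne⟩ := h
  have hfix : φ v = v := map_eq_self_of_mem_adjoin φ (fun h hh => hne h hh) hv
  have : φ.comp φ = AlgHom.id _ _ := by
    apply FreeAlgebra.hom_ext
    funext h
    by_cases hh : h = g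
    · subst hh
      change φ (φ (X.gen h)) = X.gen h
      rw [hg, map_add, hg, hfix, add_assoc, CharTwo.add_self_eq_zero, add_zero]
    · change φ (φ (X.gen h)) = X.gen h
      rw [hne h hh, hne h hh]
  exact DFunLike.congr_fun this a

theorem IsElementary.map_mem_homogeneous {X : BasedAlg} {φ : X.Alg →ₐ[ZMod 2] X.Alg}
    (h : X.IsElementary φ) {n : ℤ} {a : X.Alg} (ha : a ∈ X.homogeneous n) :
    φ a ∈ X.homogeneous n := by
  obtain ⟨g, v, -, hd, hg, hne⟩ := h
  refine BasedAlg.map_mem_homogeneous φ (fun h => ?_) ha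
  by_cases hh : h = g
  · subst hh
    rw [hg]
    exact add_mem (X.gen_mem_homogeneous h) hd
  · rw [hne h hh]
    exact X.gen_mem_homogeneous h

/-- The tame automorphisms. -/
abbrev tame (X : BasedAlg) : Submonoid (X.Alg →ₐ[ZMod 2] X.Alg) :=
  Submonoid.closure {φ | X.IsElementary φ}

theorem injective_of_mem_tame {X : BasedAlg} {φ : X.Alg →ₐ[ZMod 2] X.Alg} (h : φ ∈ X.tame) :
    Function.Injective φ := by
  induction h using Submonoid.closure_induction with
  | mem φ h => exact Function.LeftInverse.injective h.comp_self
  | one => exact Function.injective_id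
  | mul φ ψ _ _ hφ hψ => exact hφ.comp hψ

/-- The reverse implication holds because elementary automorphisms are involutions. It is what
allows degrees to be pulled back in `TameIso.isDGA`. -/
theorem mem_homogeneous_iff_of_mem_tame {X : BasedAlg} {φ : X.Alg →ₐ[ZMod 2] X.Alg}
    (h : φ ∈ X.tame) (n : ℤ) (a : X.Alg) : φ a ∈ X.homogeneous n ↔ a ∈ X.homogeneous n := by
  induction h using Submonoid.closure_induction generalizing a with
  | mem φ h =>
    refine ⟨fun ha => ?_, fun ha => h.map_mem_homogeneous ha⟩
    simpa [h.comp_self] using h.map_mem_homogeneous ha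
  | one => exact Iff.rfl
  | mul φ ψ _ _ hφ hψ => exact (hφ (ψ a)).trans (hψ a)

/-- A triangular system of substitutions is solved by a tame automorphism. -/
theorem exists_tame_of_triangular (X : BasedAlg) [Finite X.Gen] (r : X.Gen → ℕ)
    (w : X.Gen → X.Alg)
    (hw : ∀ g, w g ∈ Algebra.adjoin (ZMod 2) (X.gen '' {h | r h < r g}))
    (hd : ∀ g, w g ∈ X.homogeneous (X.deg g)) :
    ∃ φ ∈ X.tame, ∀ g, φ (X.gen g) = X.gen g + φ (w g) := by
  classical
  have := Fintype.ofFinite X.Gen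
  suffices H : ∀ s : Finset X.Gen, ∃ φ ∈ X.tame,
      (∀ g ∈ s, φ (X.gen g) = X.gen g + φ (w g)) ∧ ∀ g ∉ s, φ (X.gen g) = X.gen g by
    obtain ⟨φ, hφ, h, -⟩ := H Finset.univ
    exact ⟨φ, hφ, fun g => h g (Finset.mem_univ g)⟩
  intro s
  -- Generators are added in order of increasing rank, so the new one has maximal rank and occurs in
  -- no `w g` treated so far.
  induction s using Finset.induction_on_max_value r with
  | empty => exact ⟨1, one_mem _, by simp, by simp⟩
  | insert a s has hmax ih =>
    obtain ⟨φ, hφ, hs, hns⟩ := ih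
    set e : X.Alg →ₐ[ZMod 2] X.Alg :=
      FreeAlgebra.lift (ZMod 2) (Function.update X.gen a (X.gen a + w a)) with he
    have hea : e (X.gen a) = X.gen a + w a := by simp [he]
    have hene : ∀ h, h ≠ a → e (X.gen h) = X.gen h := by
      intro h hh
      simp [he, hh]
    have hfix : ∀ g, r g ≤ r a → e (w g) = w g := fun g hg =>
      map_eq_self_of_mem_adjoin e
        (fun h (hh : r h < r g) => hene h (by rintro rfl; omega)) (hw g)
    have hel : X.IsElementary e := by
      refine ⟨a, w a, Algebra.adjoin_mono (Set.image_mono ?_) (hw a), hd a, hea, hene⟩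
      rintro h (hh : r h < r a) rfl
      exact lt_irrefl _ hh
    -- The elementary factor acts first: `e` fixes every relevant `w g`, so `φ * e` and `φ` agree
    -- there and the equations already solved persist.
    refine ⟨φ * e, mul_mem hφ (Submonoid.subset_closure hel), ?_, ?_⟩
    · intro g hg
      simp only [AlgHom.mul_apply]
      rcases Finset.mem_insert.1 hg with rfl | hgs
      · rw [hea, map_add, hns g has, hfix g le_rfl]
      · rw [hene g (by rintro rfl; exact has hgs), hs g hgs, hfix g (hmax g hgs)]
    · intro g hg
      rw [Finset.mem_insert, not_or] at hg
      rw [AlgHom.mul_apply, hene g hg.1, hns g hg.2]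

/-! ### Relabelling of generators -/

/-- Isomorphism by a degree preserving bijection of the generators. -/
def RelabelIso (X Y : BasedAlg) : Prop :=
  ∃ σ : X.Gen ≃ Y.Gen, (∀ g, Y.deg (σ g) = X.deg g) ∧
    ∀ g, FreeAlgebra.lift (ZMod 2) (fun g => Y.gen (σ g)) (X.dGen g) = Y.dGen (σ g)

/-- Functoriality of the free algebra in its generators; compatibility of relabellings with
differentials reduces to it. -/
theorem lift_lift_gen {G H K : Type} (f : G → H) (h : H → K) (a : FreeAlgebra (ZMod 2) G) :
    FreeAlgebra.lift (ZMod 2) (fun g => FreeAlgebra.ι (ZMod 2) (h g))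
      (FreeAlgebra.lift (ZMod 2) (fun g => FreeAlgebra.ι (ZMod 2) (f g)) a) =
    FreeAlgebra.lift (ZMod 2) (fun g => FreeAlgebra.ι (ZMod 2) (h (f g))) a := by
  have : (FreeAlgebra.lift (ZMod 2) (fun g => FreeAlgebra.ι (ZMod 2) (h g))).comp
      (FreeAlgebra.lift (ZMod 2) (fun g => FreeAlgebra.ι (ZMod 2) (f g))) =
      FreeAlgebra.lift (ZMod 2) (fun g => FreeAlgebra.ι (ZMod 2) (h (f g))) := by
    apply FreeAlgebra.hom_ext
    funext g
    simp
  exact DFunLike.congr_fun this a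

theorem lift_gen_eq_self {G : Type} (a : FreeAlgebra (ZMod 2) G) :
    FreeAlgebra.lift (ZMod 2) (fun g => FreeAlgebra.ι (ZMod 2) g) a = a := by
  have : FreeAlgebra.lift (ZMod 2) (fun g : G => FreeAlgebra.ι (ZMod 2) g) = AlgHom.id _ _ := by
    apply FreeAlgebra.hom_ext
    funext g
    simp
  exact DFunLike.congr_fun this a

theorem RelabelIso.symm {X Y : BasedAlg} (h : RelabelIso X Y) : RelabelIso Y X := by
  obtain ⟨σ, hd, hσ⟩ := h
  refine ⟨σ.symm, fun g => ?_, fun g => ?_⟩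
  · rw [← hd, Equiv.apply_symm_apply]
  · have h := hσ (σ.symm g)
    rw [Equiv.apply_symm_apply] at h
    rw [← h]
    refine (lift_lift_gen σ σ.symm _).trans ?_
    simp only [Equiv.symm_apply_apply]
    exact lift_gen_eq_self _

theorem RelabelIso.trans {X Y Z : BasedAlg} (h : RelabelIso X Y) (h' : RelabelIso Y Z) :
    RelabelIso X Z := by
  obtain ⟨σ, hd, hσ⟩ := h
  obtain ⟨τ, hd', hτ⟩ := h'
  refine ⟨σ.trans τ, fun g => (hd' _).trans (hd g), fun g => ?_⟩
  have := hτ (σ g)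
  rw [← hσ g] at this
  exact (lift_lift_gen σ τ _).symm.trans this

theorem TameIso.trans_relabelIso {X Y Z : BasedAlg} (h : TameIso X Y) (h' : RelabelIso Y Z) :
    TameIso X Z := by
  obtain ⟨φ, hφ, σ, hd, hc⟩ := h
  obtain ⟨τ, hd', hτ⟩ := h'
  refine ⟨φ, hφ, σ.trans τ, fun g => (hd' _).trans (hd g), fun a => ?_⟩
  have key := map_diff (X := Y) (Y := Z)
    (FreeAlgebra.lift (ZMod 2) (fun g => Z.gen (τ g))) (fun g => by simp [hτ, diff_gen])
  have h1 := fun a => lift_lift_gen σ τ a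
  change FreeAlgebra.lift (ZMod 2) (fun g => FreeAlgebra.ι (ZMod 2) (τ (σ g))) _ =
    Z.diff (FreeAlgebra.lift (ZMod 2) (fun g => FreeAlgebra.ι (ZMod 2) (τ (σ g))) _)
  rw [← h1, ← h1]
  exact (congrArg _ (hc a)).trans (key _)

/-- The relabelling has to move past the automorphism: conjugation by it takes elementary
automorphisms to elementary ones, hence tame ones to tame ones. -/
theorem RelabelIso.trans_tameIso {X Y Z : BasedAlg} (h : RelabelIso X Y) (h' : TameIso Y Z) :
    TameIso X Z := by
  obtain ⟨σ, hd, hσ⟩ := h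
  obtain ⟨φ, hφ, τ, hd', hc⟩ := h'
  set s : X.Alg →ₐ[ZMod 2] Y.Alg := FreeAlgebra.lift (ZMod 2) (fun g => Y.gen (σ g)) with hs
  set t : Y.Alg →ₐ[ZMod 2] X.Alg := FreeAlgebra.lift (ZMod 2) (fun g => X.gen (σ.symm g)) with ht
  have hsg : ∀ g, s (X.gen g) = Y.gen (σ g) := fun g => by simp [hs]
  have htg : ∀ g, t (Y.gen g) = X.gen (σ.symm g) := fun g => by simp [ht]
  have hst : ∀ a, s (t a) = a := by
    intro a
    refine (lift_lift_gen σ.symm σ a).trans ?_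
    simp only [Equiv.apply_symm_apply]
    exact lift_gen_eq_self a
  have key := map_diff (X := X) (Y := Y) s (fun g => by rw [hσ, hsg, diff_gen])
  have conj : t.comp (φ.comp s) ∈ X.tame := by
    clear hc
    induction hφ using Submonoid.closure_induction with
    | mem φ h =>
      refine Submonoid.subset_closure ?_
      obtain ⟨g, v, hv, hvd, hg, hne⟩ := h
      refine ⟨σ.symm g, t v, ?_, ?_, ?_, ?_⟩
      · have h1 : t v ∈ (Algebra.adjoin (ZMod 2) (Y.gen '' {h | h ≠ g})).map t := ⟨v, hv, rfl⟩
        rw [AlgHom.map_adjoin] at h1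
        refine Algebra.adjoin_mono ?_ h1
        rintro _ ⟨_, ⟨h, hh, rfl⟩, rfl⟩
        exact ⟨σ.symm h, fun e => hh (σ.symm.injective e), (htg h).symm⟩
      · refine map_mem_homogeneous t (fun h => ?_) ?_
        · rw [htg]
          have := X.gen_mem_homogeneous (σ.symm h)
          rwa [← hd, Equiv.apply_symm_apply] at this
        · rwa [← hd, Equiv.apply_symm_apply]
      · change t (φ (s _)) = _
        rw [hsg, Equiv.apply_symm_apply, hg, map_add, htg]
      · intro h hh
        change t (φ (s _)) = _
        rw [hsg, hne _ (fun e => hh (by rw [← e, Equiv.symm_apply_apply])), htg,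
          Equiv.symm_apply_apply]
    | one =>
      convert one_mem X.tame
      apply FreeAlgebra.hom_ext
      funext g
      change t (s (X.gen g)) = X.gen g
      rw [hsg, htg, Equiv.symm_apply_apply]
    | mul φ ψ _ _ hφ hψ =>
      convert mul_mem hφ hψ
      ext a
      simp [hst]
  refine ⟨_, conj, σ.trans τ, fun g => (hd' _).trans (hd g), fun a => ?_⟩
  have h1 : ∀ b, FreeAlgebra.lift (ZMod 2) (fun g => Z.gen ((σ.trans τ) g)) (t b) =
      FreeAlgebra.lift (ZMod 2) (fun g => Z.gen (τ g)) b := by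
    intro b
    refine (lift_lift_gen σ.symm (fun g => τ (σ g)) b).trans ?_
    simp only [Equiv.apply_symm_apply]
  simp only [AlgHom.comp_apply]
  rw [h1, h1, key]
  exact hc _

/-- The property of being a differential graded algebra passes along tame isomorphisms. -/
theorem TameIso.isDGA {X Y : BasedAlg} (h : TameIso X Y) (hY : Y.IsDGA) : X.IsDGA := by
  obtain ⟨φ, hφ, σ, hd, hc⟩ := h
  obtain ⟨hfin, hdeg, hsq⟩ := hY
  set s : X.Alg →ₐ[ZMod 2] Y.Alg := FreeAlgebra.lift (ZMod 2) (fun g => Y.gen (σ g)) with hs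
  set t : Y.Alg →ₐ[ZMod 2] X.Alg := FreeAlgebra.lift (ZMod 2) (fun g => X.gen (σ.symm g)) with ht
  have hts : ∀ a, t (s a) = a := by
    intro a
    refine (lift_lift_gen σ σ.symm a).trans ?_
    simp only [Equiv.symm_apply_apply]
    exact lift_gen_eq_self a
  have hsh : ∀ n a, s a ∈ Y.homogeneous n ↔ a ∈ X.homogeneous n := by
    refine fun n a => ⟨fun h => ?_, fun h => map_mem_homogeneous s (fun g => ?_) h⟩
    · rw [← hts a]
      refine map_mem_homogeneous t (fun g => ?_) h
      have := X.gen_mem_homogeneous (σ.symm g)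
      rw [← hd, Equiv.apply_symm_apply] at this
      simpa [ht] using this
    · simpa [hs, hd] using Y.gen_mem_homogeneous (σ g)
  have hh : ∀ n a, s (φ a) ∈ Y.homogeneous n ↔ a ∈ X.homogeneous n := fun n a =>
    (hsh n _).trans (mem_homogeneous_iff_of_mem_tame hφ n a)
  refine ⟨Finite.of_equiv _ σ.symm, fun n a ha => ?_, fun a => ?_⟩
  · rw [← hh, hc]
    exact hdeg _ _ ((hh n a).2 ha)
  -- Tame automorphisms and relabellings are injective, so ∂² = 0 may be tested after applying both.
  · refine ((Function.LeftInverse.injective hts).comp (injective_of_mem_tame hφ)) ?_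
    simp only [Function.comp_apply]
    rw [hc, hc, hsq, map_zero, map_zero]

/-! ### Stabilization by a finite family -/

/-- The generators of a stabilization by a family of pairs. -/
inductive FamilyGen (G ι : Type) : Type
  | old (g : G)
  | top (i : ι)
  | bot (i : ι)

/-- The stabilization by a family of pairs: `∂ (top i) = bot i` and `|top i| = d i`. -/
noncomputable def stabilizeFamily (X : BasedAlg) {ι : Type} (d : ι → ℤ) : BasedAlg where
  Gen := FamilyGen X.Gen ι
  deg
    | .old g => X.deg g
    | .top i => d i
    | .bot i => d i - 1
  dGen
    | .old g => FreeAlgebra.lift (ZMod 2)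
        (fun h => FreeAlgebra.ι (ZMod 2) (FamilyGen.old h)) (X.dGen g)
    | .top i => FreeAlgebra.ι (ZMod 2) (FamilyGen.bot i)
    | .bot _ => 0

/-- Generators of families, as a sum type. -/
def familyGenEquiv (G ι : Type) : FamilyGen G ι ≃ G ⊕ ι ⊕ ι where
  toFun
    | .old g => .inl g
    | .top i => .inr (.inl i)
    | .bot i => .inr (.inr i)
  invFun
    | .inl g => .old g
    | .inr (.inl i) => .top i
    | .inr (.inr i) => .bot i
  left_inv g := by cases g <;> rfl
  right_inv g := by rcases g with g | i | i <;> rfl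

instance {G ι : Type} [Finite G] [Finite ι] : Finite (FamilyGen G ι) :=
  Finite.of_equiv _ (familyGenEquiv G ι).symm

theorem IsDGA.stabilizeFamily {X : BasedAlg} (hX : X.IsDGA) {ι : Type} [Finite ι] (d : ι → ℤ) :
    (X.stabilizeFamily d).IsDGA := by
  obtain ⟨hfin, hdeg, hsq⟩ := hX
  have : Finite (X.stabilizeFamily d).Gen := inferInstanceAs (Finite (FamilyGen X.Gen ι))
  set f : X.Alg →ₐ[ZMod 2] (X.stabilizeFamily d).Alg := FreeAlgebra.lift (ZMod 2)
        (fun h => FreeAlgebra.ι (ZMod 2) (FamilyGen.old h)) with hf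
  have hfg : ∀ g, f (X.gen g) = (X.stabilizeFamily d).gen (.old g) := fun g => by
    simp only [hf, FreeAlgebra.lift_ι_apply]
  have hfd := map_diff f (fun g =>
    ((congrArg _ (hfg g)).trans (diff_gen (X.stabilizeFamily d) (.old g))).symm)
  refine isDGA_of_gen _ ?_ ?_
  · rintro (g | i | i)
    · refine map_mem_homogeneous f (fun g => ?_) (X.diff_gen g ▸ hdeg _ _ (X.gen_mem_homogeneous g))
      rw [hfg]
      exact gen_mem_homogeneous (X.stabilizeFamily d) (.old g)
    · exact gen_mem_homogeneous (X.stabilizeFamily d) (.bot i)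
    · exact zero_mem _
  · rintro (g | i | i)
    · change BasedAlg.diff _ (f (X.dGen g)) = 0
      rw [← hfd, ← X.diff_gen, hsq, map_zero]
    · exact diff_gen (X.stabilizeFamily d) (.bot i)
    · exact map_zero _

/-- Reindexing of a family. -/
def familyGenCongr (G : Type) {ι κ : Type} (e : ι ≃ κ) : FamilyGen G ι ≃ FamilyGen G κ where
  toFun
    | .old g => .old g
    | .top i => .top (e i)
    | .bot i => .bot (e i)
  invFun
    | .old g => .old g
    | .top i => .top (e.symm i)
    | .bot i => .bot (e.symm i)
  left_inv g := by rcases g with g | i | i <;> simp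
  right_inv g := by rcases g with g | i | i <;> simp

theorem RelabelIso.stabilizeFamily_equiv (X : BasedAlg) {ι κ : Type} (e : ι ≃ κ) (d : κ → ℤ) :
    RelabelIso (X.stabilizeFamily d) (X.stabilizeFamily (d ∘ e)) := by
  refine ⟨familyGenCongr _ e.symm, ?_, ?_⟩
  · rintro (g | i | i)
    · rfl
    · exact congrArg d (e.apply_symm_apply i)
    · exact congrArg (fun j => d j - 1) (e.apply_symm_apply i)
  · rintro (g | i | i)
    · exact lift_lift_gen _ _ _
    · exact FreeAlgebra.lift_ι_apply _ _
    · exact map_zero _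

/-- Splitting off one pair of a family. -/
def familyGenOptionEquiv (G ι : Type) : FamilyGen G (Option ι) ≃ FamilyGen (StabGen G) ι where
  toFun
    | .old g => .old (.old g)
    | .top none => .old .a
    | .bot none => .old .b
    | .top (some i) => .top i
    | .bot (some i) => .bot i
  invFun
    | .old (.old g) => .old g
    | .old .a => .top none
    | .old .b => .bot none
    | .top i => .top (some i)
    | .bot i => .bot (some i)
  left_inv g := by rcases g with g | (_ | i) | (_ | i) <;> rfl
  right_inv g := by rcases g with (g | _ | _) | i | i <;> rfl

theorem RelabelIso.stabilizeFamily_option (X : BasedAlg) {ι : Type} (d : Option ι → ℤ) :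
    RelabelIso (X.stabilizeFamily d)
      ((X.stabilize (d none)).stabilizeFamily (fun i => d (some i))) := by
  refine ⟨familyGenOptionEquiv _ _, ?_, ?_⟩
  · rintro (g | (_ | i) | (_ | i)) <;> rfl
  · rintro (g | (_ | i) | (_ | i))
    · exact (lift_lift_gen _ _ _).trans (lift_lift_gen StabGen.old FamilyGen.old _).symm
    · exact (FreeAlgebra.lift_ι_apply _ _).trans
        (FreeAlgebra.lift_ι_apply (fun h => FreeAlgebra.ι (ZMod 2) (FamilyGen.old h))
          StabGen.b).symm
    · exact FreeAlgebra.lift_ι_apply _ _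
    · exact (map_zero _).trans (map_zero _).symm
    · exact map_zero _

theorem RelabelIso.stabilizeFamily_empty (X : BasedAlg) (d : PEmpty.{1} → ℤ) :
    RelabelIso (X.stabilizeFamily d) X := by
  refine ⟨(familyGenEquiv _ _).trans ((Equiv.refl _).sumCongr
    (Equiv.equivOfIsEmpty _ PEmpty.{1})|>.trans (Equiv.sumEmpty _ _)), ?_, ?_⟩
  · rintro (g | i | i)
    · rfl
    · exact i.elim
    · exact i.elim
  · rintro (g | i | i)
    · exact (lift_lift_gen _ _ _).trans (lift_gen_eq_self _)
    · exact i.elim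
    · exact i.elim

/-- A stabilization by a finite family is a successive stabilization. -/
theorem exists_relabelIso_stabilizeList (ι : Type) [Finite ι] :
    ∀ (X : BasedAlg) (d : ι → ℤ),
      ∃ l : List ℤ, RelabelIso (X.stabilizeFamily d) (X.stabilizeList l) := by
  induction ι using Finite.induction_empty_option with
  | of_equiv e ih =>
    intro X d
    obtain ⟨l, hl⟩ := ih X (d ∘ e)
    exact ⟨l, (RelabelIso.stabilizeFamily_equiv X e d).trans hl⟩
  | h_empty => exact fun X d => ⟨[], RelabelIso.stabilizeFamily_empty X d⟩
  | h_option ih =>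
    intro X d
    obtain ⟨l, hl⟩ := ih (X.stabilize (d none)) (fun i => d (some i))
    -- `stabilizeList` is a left fold, so the head of the list is the stabilization performed first.
    exact ⟨d none :: l, (RelabelIso.stabilizeFamily_option X d).trans hl⟩

end BasedAlg

namespace Lk

open BasedAlg FrontData

/-! ### Strictly upper triangular matrices of size four. -/

section algebra
variable {R : Type*} [Ring R]

/-- A strictly upper triangular matrix. -/
def strictUpper (a01 a02 a03 a12 a13 a23 : R) : Matrix (Fin 4) (Fin 4) R :=
  !![0, a01, a02, a03; 0, 0, a12, a13; 0, 0, 0, a23; 0, 0, 0, 0]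

variable (a01 a02 a03 a12 a13 a23 b01 b02 b03 b12 b13 b23 : R)

theorem strictUpper_add : strictUpper a01 a02 a03 a12 a13 a23 +
    strictUpper b01 b02 b03 b12 b13 b23 =
    strictUpper (a01 + b01) (a02 + b02) (a03 + b03) (a12 + b12) (a13 + b13) (a23 + b23) := by
  ext p q
  fin_cases p <;> fin_cases q <;> simp [strictUpper]

theorem strictUpper_mul : strictUpper a01 a02 a03 a12 a13 a23 *
    strictUpper b01 b02 b03 b12 b13 b23 =
    strictUpper 0 (a01 * b12) (a01 * b13 + a02 * b23) 0 (a12 * b23) 0 := by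
  ext p q
  fin_cases p <;> fin_cases q <;> simp [strictUpper]

theorem one_add_mul_one_add {A : Type*} [Ring A] (x y : A) :
    (1 + x) * (1 + y) = 1 + (x + y + x * y) := by
  noncomm_ring

/-- The powers shift away from the diagonal: the cube has a single entry left. In characteristic two
the sum is the inverse of 1 + N. -/
theorem sum_range_strictUpper_pow :
    ∑ i ∈ Finset.range 4, strictUpper a01 a02 a03 a12 a13 a23 ^ i =
    1 + strictUpper a01 (a02 + a01 * a12) (a03 + (a01 * a13 + a02 * a23) + a01 * a12 * a23)
      a12 (a13 + a12 * a23) a23 := by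
  rw [Finset.sum_range_succ, Finset.sum_range_succ, Finset.sum_range_succ, Finset.sum_range_one,
    pow_zero, pow_one, pow_succ _ 2, pow_two, strictUpper_mul, strictUpper_mul, add_assoc,
    add_assoc, strictUpper_add, strictUpper_add]
  simp [add_assoc]

/-- The shape of ∂`B4`, with the cusp matrix at the tip. The middle entry vanishes because the
vertex matrix has none, which makes x a cycle. -/
theorem edge_matrix :
    strictUpper a01 a02 a03 0 a13 a23 * (1 + strictUpper b01 b02 b03 b12 b13 b23) +
      (1 + strictUpper b01 b02 b03 b12 b13 b23) * strictUpper 1 0 0 0 0 1 =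
    strictUpper (a01 + 1) (a02 + a01 * b12) (a03 + a01 * b13 + a02 * b23 + b02)
      0 (a13 + b12) (a23 + 1) := by
  rw [mul_add, add_mul, mul_one, one_mul]
  simp only [strictUpper_mul, strictUpper_add]
  simp [add_assoc]

/-- The shape of ∂`C2`: the sides `s`, `t` of the lens, followed by the crossing circle `b`
conjugated by the edge `a`. Since `b` has no middle entry, neither has its conjugate. -/
theorem conj_matrix [CharP R 2] (c01 c02 c03 c12 c13 c23 s t : R) :
    strictUpper 1 0 0 0 0 1 * strictUpper c01 c02 c03 c12 c13 c23 +
      strictUpper c01 c02 c03 c12 c13 c23 * strictUpper 1 0 0 0 0 1 +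
      (∑ i ∈ Finset.range 4, strictUpper a01 a02 a03 a12 a13 a23 ^ i) *
      ((1 + strictUpper b01 b02 b03 0 b13 b23) *
       ((1 + strictUpper a01 a02 a03 a12 a13 a23) *
        ((1 + strictUpper 0 0 0 0 0 t) * ((1 + strictUpper s 0 0 0 0 0) * 1)))) + 1 =
    strictUpper (s + b01) (c12 + (b02 + b01 * a12))
        (c13 + c02 + (b03 + b01 * a13 + b02 * a23 + a01 * b13 + a02 * b23 +
          a01 * a12 * b23 + b02 * t + b01 * a12 * t))
       0 (c12 + (b13 + a12 * b23)) (t + b23) := by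
  have h1 : (1 : Matrix (Fin 4) (Fin 4) R) + 1 = 0 := by
    ext p q
    exact CharTwo.add_self_eq_zero _
  rw [sum_range_strictUpper_pow, mul_one]
  simp only [one_add_mul_one_add, strictUpper_mul, strictUpper_add]
  rw [add_comm 1 (strictUpper _ _ _ _ _ _), add_assoc, add_assoc, add_assoc, h1,
    add_zero (strictUpper _ _ _ _ _ _), strictUpper_add]
  congr 1 <;> grind

end algebra

/-- The cancelling pairs of generators above a lens: `A pq` pairs the generators of `B4` and of the
vertex `A`, `B pq` those of `C3` and of `B3`, `S1` and `S2` those of `C2` and of the sides of the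
lens, and `M` and `T` pair generators of `C2`. -/
inductive Pair : Type
  | A01 | A02 | A03 | A13 | A23
  | B01 | B02 | B03 | B13 | B23
  | S1 | S2 | M | T

instance : Finite Pair := by
  have h : ({.A01, .A02, .A03, .A13, .A23, .B01, .B02, .B03, .B13, .B23, .S1, .S2, .M, .T} :
      Set Pair).Finite := Set.toFinite _
  exact Set.finite_univ_iff.1 (h.subset (by rintro (_ | _) _ <;> simp))

/-- The degree of the first generator of a pair. -/
def Pair.deg : Pair → ℤ
  | .A01 => 1 | .A02 => 0 | .A03 => 1 | .A13 => 0 | .A23 => 1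
  | .B01 => 2 | .B02 => 1 | .B03 => 2 | .B13 => 1 | .B23 => 2
  | .S1 => 2 | .S2 => 2 | .M => 1 | .T => 2

/-- The generators of the cellular algebra, sorted into cancelling pairs. -/
abbrev SortedGen (k : ℕ) : Type := FamilyGen (ModelGen k) (Fin k × Pair)

/-- The generator of the cellular algebra with a given name. -/
def toGen (k : ℕ) [NeZero k] : SortedGen k → (front k).Gen
  | .old (.x j) => ⟨.edge (.B4 j), (1 : Fin 4), (2 : Fin 4), rfl⟩
  | .old (.y j) => ⟨.face (.C3 j), (1 : Fin 4), (2 : Fin 4), rfl⟩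
  | .old .z => ⟨.face .C1, (0 : Fin 2), (1 : Fin 2), rfl⟩
  | .top (j, .A01) => ⟨.edge (.B4 j), (0 : Fin 4), (1 : Fin 4), rfl⟩
  | .top (j, .A02) => ⟨.edge (.B4 j), (0 : Fin 4), (2 : Fin 4), rfl⟩
  | .top (j, .A03) => ⟨.edge (.B4 j), (0 : Fin 4), (3 : Fin 4), rfl⟩
  | .top (j, .A13) => ⟨.edge (.B4 j), (1 : Fin 4), (3 : Fin 4), rfl⟩
  | .top (j, .A23) => ⟨.edge (.B4 j), (2 : Fin 4), (3 : Fin 4), rfl⟩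
  | .bot (j, .A01) => ⟨.vertex (.A j), (0 : Fin 4), (1 : Fin 4), rfl⟩
  | .bot (j, .A02) => ⟨.vertex (.A j), (0 : Fin 4), (2 : Fin 4), rfl⟩
  | .bot (j, .A03) => ⟨.vertex (.A j), (0 : Fin 4), (3 : Fin 4), rfl⟩
  | .bot (j, .A13) => ⟨.vertex (.A j), (1 : Fin 4), (3 : Fin 4), rfl⟩
  | .bot (j, .A23) => ⟨.vertex (.A j), (2 : Fin 4), (3 : Fin 4), rfl⟩
  -- Above `C3` the two middle sheets are exchanged, so its sheets 0, 1 bound the sheets 0, 2 of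
  -- `B3`, and likewise for the other pairs.
  | .top (j, .B02) => ⟨.face (.C3 j), (0 : Fin 4), (1 : Fin 4), rfl⟩
  | .top (j, .B01) => ⟨.face (.C3 j), (0 : Fin 4), (2 : Fin 4), rfl⟩
  | .top (j, .B03) => ⟨.face (.C3 j), (0 : Fin 4), (3 : Fin 4), rfl⟩
  | .top (j, .B23) => ⟨.face (.C3 j), (1 : Fin 4), (3 : Fin 4), rfl⟩
  | .top (j, .B13) => ⟨.face (.C3 j), (2 : Fin 4), (3 : Fin 4), rfl⟩
  | .bot (j, .B01) => ⟨.edge (.B3 j), (0 : Fin 4), (1 : Fin 4), rfl⟩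
  | .bot (j, .B02) => ⟨.edge (.B3 j), (0 : Fin 4), (2 : Fin 4), rfl⟩
  | .bot (j, .B03) => ⟨.edge (.B3 j), (0 : Fin 4), (3 : Fin 4), rfl⟩
  | .bot (j, .B13) => ⟨.edge (.B3 j), (1 : Fin 4), (3 : Fin 4), rfl⟩
  | .bot (j, .B23) => ⟨.edge (.B3 j), (2 : Fin 4), (3 : Fin 4), rfl⟩
  | .top (j, .S1) => ⟨.face (.C2 j), (0 : Fin 4), (1 : Fin 4), rfl⟩
  | .bot (j, .S1) => ⟨.edge (.B1 j), (0 : Fin 2), (1 : Fin 2), rfl⟩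
  | .top (j, .S2) => ⟨.face (.C2 j), (2 : Fin 4), (3 : Fin 4), rfl⟩
  | .bot (j, .S2) => ⟨.edge (.B2 j), (0 : Fin 2), (1 : Fin 2), rfl⟩
  | .top (j, .M) => ⟨.face (.C2 j), (0 : Fin 4), (2 : Fin 4), rfl⟩
  | .bot (j, .M) => ⟨.face (.C2 j), (1 : Fin 4), (2 : Fin 4), rfl⟩
  | .top (j, .T) => ⟨.face (.C2 j), (0 : Fin 4), (3 : Fin 4), rfl⟩
  | .bot (j, .T) => ⟨.face (.C2 j), (1 : Fin 4), (3 : Fin 4), rfl⟩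

/-- The name of the generator with given cell and numbers of sheets. -/
def sortedGen (k : ℕ) : Cell (Vert k) (Edge k) (Face k) → ℕ → ℕ → SortedGen k
  | .edge (.B4 j), 1, 2 => .old (.x j)
  | .face (.C3 j), 1, 2 => .old (.y j)
  | .edge (.B4 j), 0, 1 => .top (j, .A01)
  | .edge (.B4 j), 0, 2 => .top (j, .A02)
  | .edge (.B4 j), 0, 3 => .top (j, .A03)
  | .edge (.B4 j), 1, 3 => .top (j, .A13)
  | .edge (.B4 j), 2, 3 => .top (j, .A23)
  | .vertex (.A j), 0, 1 => .bot (j, .A01)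
  | .vertex (.A j), 0, 2 => .bot (j, .A02)
  | .vertex (.A j), 0, 3 => .bot (j, .A03)
  | .vertex (.A j), 1, 3 => .bot (j, .A13)
  | .vertex (.A j), 2, 3 => .bot (j, .A23)
  | .face (.C3 j), 0, 1 => .top (j, .B02)
  | .face (.C3 j), 0, 2 => .top (j, .B01)
  | .face (.C3 j), 0, 3 => .top (j, .B03)
  | .face (.C3 j), 1, 3 => .top (j, .B23)
  | .face (.C3 j), 2, 3 => .top (j, .B13)
  | .edge (.B3 j), 0, 1 => .bot (j, .B01)
  | .edge (.B3 j), 0, 2 => .bot (j, .B02)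
  | .edge (.B3 j), 0, 3 => .bot (j, .B03)
  | .edge (.B3 j), 1, 3 => .bot (j, .B13)
  | .edge (.B3 j), 2, 3 => .bot (j, .B23)
  | .face (.C2 j), 0, 1 => .top (j, .S1)
  | .edge (.B1 j), 0, 1 => .bot (j, .S1)
  | .face (.C2 j), 2, 3 => .top (j, .S2)
  | .edge (.B2 j), 0, 1 => .bot (j, .S2)
  | .face (.C2 j), 0, 2 => .top (j, .M)
  | .face (.C2 j), 1, 2 => .bot (j, .M)
  | .face (.C2 j), 0, 3 => .top (j, .T)
  | .face (.C2 j), 1, 3 => .bot (j, .T)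
  -- This covers the pair above `C1`; the other inputs that end here are not pairs of sheets with
  -- the first above the second.
  | _, _, _ => .old .z

theorem toGen_sortedGen (k : ℕ) [NeZero k] :
    (c : Cell (Vert k) (Edge k) (Face k)) → (p q : Fin (num k c)) → (h : above k c p q = true) →
    toGen k (sortedGen k c p q) = ⟨c, p, q, h⟩
  | .vertex (.tip _), p, _, _ => p.elim0
  | .vertex (.outerTip _), p, _, _ => p.elim0
  | .edge (.hole _), p, _, _ => p.elim0
  | .edge (.outer _), p, _, _ => p.elim0
  | .vertex (.A _), p, q, h => by
      change Fin 4 at p q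
      fin_cases p <;> fin_cases q <;> first | rfl | exact absurd h Bool.false_ne_true
  | .edge (.B1 _), p, q, h => by
      change Fin 2 at p q
      fin_cases p <;> fin_cases q <;> first | rfl | exact absurd h Bool.false_ne_true
  | .edge (.B2 _), p, q, h => by
      change Fin 2 at p q
      fin_cases p <;> fin_cases q <;> first | rfl | exact absurd h Bool.false_ne_true
  | .edge (.B3 _), p, q, h => by
      change Fin 4 at p q
      fin_cases p <;> fin_cases q <;> first | rfl | exact absurd h Bool.false_ne_true
  | .edge (.B4 _), p, q, h => by
      change Fin 4 at p q
      fin_cases p <;> fin_cases q <;> first | rfl | exact absurd h Bool.false_ne_true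
  | .face .C1, p, q, h => by
      change Fin 2 at p q
      fin_cases p <;> fin_cases q <;> first | rfl | exact absurd h Bool.false_ne_true
  | .face (.C2 _), p, q, h => by
      change Fin 4 at p q
      fin_cases p <;> fin_cases q <;> first | rfl | exact absurd h Bool.false_ne_true
  | .face (.C3 _), p, q, h => by
      change Fin 4 at p q
      fin_cases p <;> fin_cases q <;> first | rfl | exact absurd h Bool.false_ne_true

/-- The bijection between generators and their names. -/
def genEquiv (k : ℕ) [NeZero k] : SortedGen k ≃ (front k).Gen where
  toFun := toGen k
  invFun g := sortedGen k g.cell g.p.val g.q.val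
  left_inv g := by rcases g with (_ | _ | _) | ⟨j, i⟩ | ⟨j, i⟩ <;> first | rfl | (cases i <;> rfl)
  right_inv g := toGen_sortedGen k g.cell g.p g.q g.isAbove

/-! ### The matrices of the cells -/

section matrices

variable {k : ℕ} [NeZero k] (j : Fin k)

/-- A first generator of a pair, in the cellular algebra. -/
noncomputable abbrev top (j : Fin k) (i : Pair) : (front k).Alg :=
  FreeAlgebra.ι (ZMod 2) (toGen k (.top (j, i)))

/-- A second generator of a pair, in the cellular algebra. -/
noncomputable abbrev bot (j : Fin k) (i : Pair) : (front k).Alg :=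
  FreeAlgebra.ι (ZMod 2) (toGen k (.bot (j, i)))

/-- The generator of the middle two sheets above `B4`. -/
noncomputable abbrev genX (j : Fin k) : (front k).Alg :=
  FreeAlgebra.ι (ZMod 2) (toGen k (.old (.x j)))

/-- The generator of the middle two sheets above `C3`. -/
noncomputable abbrev genY (j : Fin k) : (front k).Alg :=
  FreeAlgebra.ι (ZMod 2) (toGen k (.old (.y j)))

/-- The matrix of the vertex `A`. -/
noncomputable def matA : Matrix (Fin 4) (Fin 4) (front k).Alg :=
  strictUpper (bot j .A01) (bot j .A02) (bot j .A03) 0 (bot j .A13) (bot j .A23)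

/-- The matrix of the vertex `A`, with the order of the sheets above `C3`. -/
noncomputable def matASwap : Matrix (Fin 4) (Fin 4) (front k).Alg :=
  strictUpper (bot j .A02) (bot j .A01) (bot j .A03) 0 (bot j .A23) (bot j .A13)

/-- The matrix of the edge `B3`. -/
noncomputable def matB : Matrix (Fin 4) (Fin 4) (front k).Alg :=
  strictUpper (bot j .B01) (bot j .B02) (bot j .B03) 0 (bot j .B13) (bot j .B23)

/-- The matrix of the edge `B3`, with the order of the sheets above `C3`. -/
noncomputable def matBSwap : Matrix (Fin 4) (Fin 4) (front k).Alg :=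
  strictUpper (bot j .B02) (bot j .B01) (bot j .B03) 0 (bot j .B23) (bot j .B13)

/-- The matrix of the edge `B4`. -/
noncomputable def matB4 : Matrix (Fin 4) (Fin 4) (front k).Alg :=
  strictUpper (top j .A01) (top j .A02) (top j .A03) (genX j) (top j .A13) (top j .A23)

/-- The matrix of the face `C2`. -/
noncomputable def matC2 : Matrix (Fin 4) (Fin 4) (front k).Alg :=
  strictUpper (top j .S1) (top j .M) (top j .T) (bot j .M) (bot j .T) (top j .S2)

/-- The matrix of the face `C3`. -/
noncomputable def matC3 : Matrix (Fin 4) (Fin 4) (front k).Alg :=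
  strictUpper (top j .B02) (top j .B01) (top j .B03) (genY j) (top j .B23) (top j .B13)

/-- The matrix of a pair of cusps. -/
noncomputable def matCusps (k : ℕ) [NeZero k] : Matrix (Fin 4) (Fin 4) (front k).Alg :=
  strictUpper 1 0 0 0 0 1

theorem mat_A : (front k).mat (.vertex (.A j)) = matA j := by
  ext p q
  -- The index type is `Fin (num k _)`; the case split needs it in the form `Fin 4`.
  change Fin 4 at p q
  fin_cases p <;> fin_cases q <;> rfl

theorem mat_B3 : (front k).mat (.edge (.B3 j)) = matB j := by
  ext p q
  change Fin 4 at p q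
  fin_cases p <;> fin_cases q <;> rfl

theorem mat_B4 : (front k).mat (.edge (.B4 j)) = matB4 j := by
  ext p q
  change Fin 4 at p q
  fin_cases p <;> fin_cases q <;> rfl

theorem mat_C2 : (front k).mat (.face (.C2 j)) = matC2 j := by
  ext p q
  change Fin 4 at p q
  fin_cases p <;> fin_cases q <;> rfl

theorem mat_C3 : (front k).mat (.face (.C3 j)) = matC3 j := by
  ext p q
  change Fin 4 at p q
  fin_cases p <;> fin_cases q <;> rfl

theorem vertexMat_same : (front k).vertexMat (.A j) (sameSheets 4) = matA j := by
  ext p q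
  change Fin 4 at p q
  fin_cases p <;> fin_cases q <;> rfl

theorem vertexMat_swap : (front k).vertexMat (.A j) swapSheets = matASwap j := by
  ext p q
  change Fin 4 at p q
  fin_cases p <;> fin_cases q <;> rfl

theorem vertexMat_cusps : (front k).vertexMat (.tip j) (allCusps 4 0) = matCusps k := by
  ext p q
  change Fin 4 at p q
  fin_cases p <;> fin_cases q <;> rfl

theorem edgeMat_B3 : (front k).edgeMat (.B3 j) (fun i : Fin 4 => some i) = matB j := by
  ext p q
  change Fin 4 at p q
  fin_cases p <;> fin_cases q <;> rfl

theorem edgeMat_B3_swap : (front k).edgeMat (.B3 j)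
    (![some 0, some 2, some 1, some 3] : Fin 4 → Option (Fin 4)) = matBSwap j := by
  ext p q
  change Fin 4 at p q
  fin_cases p <;> fin_cases q <;> rfl

theorem edgeMat_B4 : (front k).edgeMat (.B4 j) (fun i : Fin 4 => some i) = matB4 j := by
  ext p q
  change Fin 4 at p q
  fin_cases p <;> fin_cases q <;> rfl

theorem edgeMat_B1 : (front k).edgeMat (.B1 j)
    (![some 0, some 1, none, none] : Fin 4 → Option (Fin 2)) =
    strictUpper (bot j .S1) 0 0 0 0 0 := by
  ext p q
  change Fin 4 at p q
  fin_cases p <;> fin_cases q <;> rfl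

theorem edgeMat_B2 : (front k).edgeMat (.B2 j)
    (![none, none, some 0, some 1] : Fin 4 → Option (Fin 2)) =
    strictUpper 0 0 0 0 0 (bot j .S2) := by
  ext p q
  change Fin 4 at p q
  fin_cases p <;> fin_cases q <;> rfl

theorem mat_C1 : (front k).mat (.face .C1) =
    !![0, FreeAlgebra.ι (ZMod 2) (toGen k (.old .z)); 0, 0] := by
  ext p q
  change Fin 2 at p q
  fin_cases p <;> fin_cases q <;> rfl

theorem mat_B1 : (front k).mat (.edge (.B1 j)) = !![0, bot j .S1; 0, 0] := by
  ext p q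
  change Fin 2 at p q
  fin_cases p <;> fin_cases q <;> rfl

theorem mat_B2 : (front k).mat (.edge (.B2 j)) = !![0, bot j .S2; 0, 0] := by
  ext p q
  change Fin 2 at p q
  fin_cases p <;> fin_cases q <;> rfl

theorem vertexMat_cusp_tip : (front k).vertexMat (.tip j) (allCusps 2 0) = !![0, 1; 0, 0] := by
  ext p q
  change Fin 2 at p q
  fin_cases p <;> fin_cases q <;> rfl

theorem vertexMat_cusp_outerTip :
    (front k).vertexMat (.outerTip j) (allCusps 2 0) = !![0, 1; 0, 0] := by
  ext p q
  change Fin 2 at p q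
  fin_cases p <;> fin_cases q <;> rfl

theorem one_add_unipotent {R : Type*} [Ring R] (b : R) :
    1 + !![0, b; 0, 0] = !![1, b; 0, 1] := by
  ext p q
  fin_cases p <;> fin_cases q <;> simp

theorem stepMat_B1 :
    (front k).stepMat ⟨.B1 j, true, fun i : Fin 2 => some i⟩ = !![1, bot j .S1; 0, 1] := by
  change 1 + (front k).mat (.edge (.B1 j)) = _
  rw [mat_B1]
  exact one_add_unipotent _

theorem stepMat_B2 :
    (front k).stepMat ⟨.B2 j, true, fun i : Fin 2 => some i⟩ = !![1, bot j .S2; 0, 1] := by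
  change 1 + (front k).mat (.edge (.B2 j)) = _
  rw [mat_B2]
  exact one_add_unipotent _

/-- Boundary edges of the base projection carry no sheets and do not contribute to ∂`C1`. -/
theorem stepMat_empty (e : Edge k) :
    (front k).stepMat ⟨e, true, fun _ : Fin 2 => none⟩ = !![1, 0; 0, 1] := by
  ext p q
  fin_cases p <;> fin_cases q <;> simp [stepMat, edgeMat]

end matrices

/-! ### The differentials of the generators of each cell. -/

section differentials

variable {k : ℕ} [NeZero k] (j : Fin k)

/-- The type of the equation is given explicitly because the number of sheets equals 4 only by
unfolding, while the matrix lemmas are about `Fin 4`. -/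
theorem dMat_A : Eq (α := Matrix (Fin 4) (Fin 4) (front k).Alg) ((front k).dMat (.vertex (.A j))) <|
    matA j * matA j := by
  rw [← mat_A]
  rfl

theorem dMat_B3 : Eq (α := Matrix (Fin 4) (Fin 4) (front k).Alg) ((front k).dMat (.edge (.B3 j))) <|
   
    matA j * (1 + matB j) + (1 + matB j) * matA j := by
  rw [← mat_B3, ← vertexMat_same]
  rfl

theorem dMat_B4 : Eq (α := Matrix (Fin 4) (Fin 4) (front k).Alg) ((front k).dMat (.edge (.B4 j))) <|
   
    matA j * (1 + matB4 j) + (1 + matB4 j) * matCusps k := by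
  rw [← mat_B4, ← vertexMat_same, ← vertexMat_cusps j]
  rfl

theorem dMat_C3 : Eq (α := Matrix (Fin 4) (Fin 4) (front k).Alg) ((front k).dMat (.face (.C3 j))) <|
   
    matASwap j * matC3 j + matC3 j * matASwap j + (1 + matBSwap j) * 1 + 1 := by
  rw [← mat_C3, ← vertexMat_swap, ← edgeMat_B3_swap]
  rfl

theorem dMat_C2 : Eq (α := Matrix (Fin 4) (Fin 4) (front k).Alg) ((front k).dMat (.face (.C2 j))) <|
   
    matCusps k * matC2 j + matC2 j * matCusps k +
      (∑ i ∈ Finset.range 4, matB4 j ^ i) * ((1 + matB j) * ((1 + matB4 j) *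
        ((1 + strictUpper 0 0 0 0 0 (bot j .S2)) *
          ((1 + strictUpper (bot j .S1) 0 0 0 0 0) * 1)))) + 1 := by
  rw [← mat_C2, ← vertexMat_cusps j, ← edgeMat_B4, ← edgeMat_B3, ← edgeMat_B1, ← edgeMat_B2]
  rfl

/-- With this instance `grind` can cancel repeated terms in the free algebra. -/
instance {X : Type} : CharP (FreeAlgebra (ZMod 2) X) 2 := FreeAlgebra.charP 2

theorem dMat_A_eq : Eq (α := Matrix (Fin 4) (Fin 4) (front k).Alg)
    ((front k).dMat (.vertex (.A j))) <|
    strictUpper 0 0 (bot j .A01 * bot j .A13 + bot j .A02 * bot j .A23) 0 0 0 := by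
  rw [dMat_A, matA, strictUpper_mul]
  simp

theorem dMat_B4_eq : Eq (α := Matrix (Fin 4) (Fin 4) (front k).Alg)
    ((front k).dMat (.edge (.B4 j))) <|
    strictUpper (bot j .A01 + 1) (bot j .A02 + bot j .A01 * genX j)
      (bot j .A03 + bot j .A01 * top j .A13 + bot j .A02 * top j .A23 + top j .A02)
      0 (bot j .A13 + genX j) (bot j .A23 + 1) :=
  (dMat_B4 j).trans (edge_matrix _ _ _ _ _ _ _ _ _ _ _)

/-- The linear terms A + A cancel. As neither matrix has a middle entry, the products AB and BA live
in the corner only. -/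
theorem dMat_B3_eq : Eq (α := Matrix (Fin 4) (Fin 4) (front k).Alg)
    ((front k).dMat (.edge (.B3 j))) <|
    strictUpper 0 0 (bot j .A01 * bot j .B13 + bot j .A02 * bot j .B23 +
      bot j .B01 * bot j .A13 + bot j .B02 * bot j .A23) 0 0 0 := by
  rw [dMat_B3, matA, matB, mul_add, add_mul, mul_one, one_mul]
  simp only [strictUpper_mul, strictUpper_add]
  congr 1 <;> grind

/-- The source of the products in ∂z: `genY` stands to the right of A02 in one entry and to the left
of A13 in another, and both of these become x. The zero in the middle makes y a cycle. -/
theorem dMat_C3_eq : Eq (α := Matrix (Fin 4) (Fin 4) (front k).Alg)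
    ((front k).dMat (.face (.C3 j))) <|
    strictUpper (bot j .B02) (bot j .B01 + bot j .A02 * genY j)
      (bot j .B03 + bot j .A02 * top j .B23 + bot j .A01 * top j .B13 +
        top j .B02 * bot j .A23 + top j .B01 * bot j .A13)
      0 (bot j .B23 + genY j * bot j .A13) (bot j .B13) := by
  have h1 : (1 : Matrix (Fin 4) (Fin 4) (front k).Alg) + 1 = 0 := by
    ext p q
    exact CharTwo.add_self_eq_zero _
  rw [dMat_C3, matASwap, matC3, matBSwap, mul_one, add_comm 1 (strictUpper _ _ _ _ _ _),
    add_assoc, add_assoc, add_assoc, h1,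
    add_zero (strictUpper _ _ _ _ _ _)]
  simp only [strictUpper_mul, strictUpper_add]
  congr 1 <;> grind

theorem dMat_C2_eq : Eq (α := Matrix (Fin 4) (Fin 4) (front k).Alg)
    ((front k).dMat (.face (.C2 j))) <|
    strictUpper (bot j .S1 + bot j .B01) (bot j .M + (bot j .B02 + bot j .B01 * genX j))
      (bot j .T + top j .M + (bot j .B03 + bot j .B01 * top j .A13 + bot j .B02 * top j .A23 +
        top j .A01 * bot j .B13 + top j .A02 * bot j .B23 + top j .A01 * genX j * bot j .B23 +
        bot j .B02 * bot j .S2 + bot j .B01 * genX j * bot j .S2))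
      0 (bot j .M + (bot j .B13 + genX j * bot j .B23)) (bot j .S2 + bot j .B23) :=
  (dMat_C2 j).trans (conj_matrix _ _ _ _ _ _ _ _ _ _ _ _ _ _ _ _ _ _ _)

/-- Strictly upper triangular matrices of size two multiply to zero, so only the two equal cusp
terms remain, and they cancel. -/
theorem cusp_edge_matrix {R : Type*} [Ring R] [CharP R 2] {b : R}
    {V W B : Matrix (Fin 2) (Fin 2) R} (hV : V = !![0, 1; 0, 0]) (hW : W = !![0, 1; 0, 0])
    (hB : B = !![0, b; 0, 0]) : V * (1 + B) + (1 + B) * W = 0 := by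
  rw [hV, hW, hB, mul_add, add_mul, mul_one, one_mul]
  ext p q
  fin_cases p <;> fin_cases q <;> simp [CharTwo.add_self_eq_zero]

theorem dMat_B1 : Eq (α := Matrix (Fin 2) (Fin 2) (front k).Alg)
    ((front k).dMat (.edge (.B1 j))) 0 :=
  cusp_edge_matrix (vertexMat_cusp_outerTip j) (vertexMat_cusp_tip j) (mat_B1 j)

theorem dMat_B2 : Eq (α := Matrix (Fin 2) (Fin 2) (front k).Alg)
    ((front k).dMat (.edge (.B2 j))) 0 :=
  cusp_edge_matrix (vertexMat_cusp_tip j) (vertexMat_cusp_outerTip j) (mat_B2 j)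

/-- Unipotent matrices of size two multiply by adding their corners. So only the sum over the edges
of `C1` matters, not their cyclic order. -/
theorem foldl_unipotent {R α : Type*} [Ring R] (f : α → Matrix (Fin 2) (Fin 2) R) (l : List α)
    (hf : ∀ s ∈ l, f s = !![1, f s 0 1; 0, 1]) (c : R) :
    l.foldl (fun M s => f s * M) !![1, c; 0, 1] =
      !![1, c + (l.map fun s => f s 0 1).sum; 0, 1] := by
  induction l generalizing c with
  | nil => simp
  | cons s l ih =>
    have h : f s * !![1, c; 0, 1] = !![1, c + f s 0 1; 0, 1] := by
      rw [hf s List.mem_cons_self]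
      ext p q
      fin_cases p <;> fin_cases q <;> simp
    rw [List.foldl_cons, h, ih fun s hs => hf s (List.mem_cons_of_mem _ hs)]
    simp [add_assoc]

theorem eq_unipotent_of_eq {R : Type*} [Ring R] {M : Matrix (Fin 2) (Fin 2) R} {b : R}
    (h : M = !![1, b; 0, 1]) : M = !![1, M 0 1; 0, 1] := by
  rw [h]
  rfl

/-- The steps of a path in the boundary of `C1`. -/
abbrev StepC1 (k : ℕ) : Type :=
  (e : Edge k) × Bool × (Fin 2 → Option (Fin (num k (.edge e))))

/-- A step along `B1`. -/
def stepB1 : StepC1 k := ⟨.B1 j, true, fun i : Fin 2 => some i⟩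

/-- A step along `B2`. -/
def stepB2 : StepC1 k := ⟨.B2 j, true, fun i : Fin 2 => some i⟩

/-- A step along an edge without sheets. -/
def stepEmpty (e : Edge k) : StepC1 k := ⟨e, true, fun _ => none⟩

theorem boundary_C1 : Eq (α := List (StepC1 k)) (boundary k .C1) <|
    [stepB1 0, stepEmpty (.outer 0)] ++
      (List.finRange k).tail.flatMap (fun j =>
        [stepB2 j, stepEmpty (.hole j), stepB1 j, stepEmpty (.outer j)]) ++
      [stepB2 0, stepEmpty (.hole 0)] := rfl

theorem pathMat_C1 : Eq (α := Matrix (Fin 2) (Fin 2) (front k).Alg)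
    ((front k).pathMat (boundary k .C1))
    !![1, ∑ j, (bot j .S1 + bot j .S2); 0, 1] := by
  have h1 : (1 : Matrix (Fin 2) (Fin 2) (front k).Alg) = !![1, 0; 0, 1] := by
    ext p q
    fin_cases p <;> fin_cases q <;> rfl
  let f : StepC1 k → Matrix (Fin 2) (Fin 2) (front k).Alg := fun s => (front k).stepMat s
  suffices h : ((boundary k .C1 : List (StepC1 k))).foldl (fun M s => f s * M) 1 =
      !![1, ∑ j, (bot j .S1 + bot j .S2); 0, 1] from h
  have hB1 : ∀ j, f (stepB1 j) = !![1, bot j .S1; 0, 1] := stepMat_B1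
  have hB2 : ∀ j, f (stepB2 j) = !![1, bot j .S2; 0, 1] := stepMat_B2
  have hE : ∀ e, f (stepEmpty e) = !![1, 0; 0, 1] := stepMat_empty
  clear_value f
  rw [h1, boundary_C1, foldl_unipotent]
  · congr
    rw [zero_add]
    -- The boundary starts at the tip of lens 0, whose two sides therefore stand at the two ends of
    -- the path; index 0 is split off the sum to match.
    obtain ⟨n, rfl⟩ := Nat.exists_eq_succ_of_ne_zero (NeZero.ne k)
    rw [Fin.sum_univ_succ, ← List.sum_ofFn, List.ofFn_eq_map]
    simp only [List.map_append, List.sum_append, List.map_cons, List.map_nil,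
      List.sum_cons, List.sum_nil, hB1, hB2, hE, List.finRange_succ, List.tail_cons,
      List.map_flatMap]
    simp [List.flatMap_def, List.sum_flatten, Function.comp_def, List.sum_map_add]
    abel
  · intro s hs
    simp only [List.mem_append, List.mem_flatMap, List.mem_cons, List.not_mem_nil,
      or_false] at hs
    rcases hs with ((rfl | rfl) | ⟨j, -, rfl | rfl | rfl | rfl⟩) | rfl | rfl
    all_goals
      first
      | exact eq_unipotent_of_eq (hE _)
      | exact eq_unipotent_of_eq (hB1 _)
      | exact eq_unipotent_of_eq (hB2 _)

theorem dMat_C1 : Eq (α := Matrix (Fin 2) (Fin 2) (front k).Alg)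
    ((front k).dMat (.face .C1)) <|
    !![0, 1; 0, 0] * !![0, FreeAlgebra.ι (ZMod 2) (toGen k (.old .z)); 0, 0] +
      !![0, FreeAlgebra.ι (ZMod 2) (toGen k (.old .z)); 0, 0] * !![0, 1; 0, 0] +
      !![1, ∑ j, (bot j .S1 + bot j .S2); 0, 1] + 1 := by
  rw [← mat_C1, ← pathMat_C1, ← vertexMat_cusp_tip 0]
  rfl

theorem dMat_C1_eq : Eq (α := Matrix (Fin 2) (Fin 2) (front k).Alg)
    ((front k).dMat (.face .C1)) <| !![0, ∑ j, (bot j .S1 + bot j .S2); 0, 0] := by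
  rw [dMat_C1]
  ext p q
  fin_cases p <;> fin_cases q <;> simp [CharTwo.add_self_eq_zero]

end differentials

/-! ### The cellular algebra with sorted generators -/

/-- The free algebra on the sorted generators. -/
abbrev SortedAlg (k : ℕ) : Type := FreeAlgebra (ZMod 2) (SortedGen k)

section sorted

variable {k : ℕ}

/-- The first generator of a pair. -/
def topGen (j : Fin k) (i : Pair) : SortedAlg k := FreeAlgebra.ι (ZMod 2) (.top (j, i))

/-- The second generator of a pair. -/
def botGen (j : Fin k) (i : Pair) : SortedAlg k := FreeAlgebra.ι (ZMod 2) (.bot (j, i))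

/-- The generator `x`. -/
def xGen (j : Fin k) : SortedAlg k := FreeAlgebra.ι (ZMod 2) (.old (.x j))

/-- The generator `y`. -/
def yGen (j : Fin k) : SortedAlg k := FreeAlgebra.ι (ZMod 2) (.old (.y j))

/-- The generator `z`. -/
def zGen : SortedAlg k := FreeAlgebra.ι (ZMod 2) (.old .z)

/-- The remainder of the differential of the first generator of a pair, after the second. -/
noncomputable def remainder (j : Fin k) : Pair → SortedAlg k
  | .A01 => 1
  | .A02 => botGen j .A01 * xGen j
  | .A03 => botGen j .A01 * topGen j .A13 + botGen j .A02 * topGen j .A23 + topGen j .A02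
  | .A13 => xGen j
  | .A23 => 1
  | .B01 => botGen j .A02 * yGen j
  | .B02 => 0
  | .B03 => botGen j .A02 * topGen j .B23 + botGen j .A01 * topGen j .B13 +
      topGen j .B02 * botGen j .A23 +
      topGen j .B01 * botGen j .A13
  | .B13 => 0
  | .B23 => yGen j * botGen j .A13
  | .S1 => botGen j .B01
  | .S2 => botGen j .B23
  | .M => botGen j .B02 + botGen j .B01 * xGen j
  | .T => topGen j .M + botGen j .B03 + botGen j .B01 * topGen j .A13 +
      botGen j .B02 * topGen j .A23 +
      topGen j .A01 * botGen j .B13 + topGen j .A02 * botGen j .B23 +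
      topGen j .A01 * xGen j * botGen j .B23 + botGen j .B02 * botGen j .S2 +
      botGen j .B01 * xGen j * botGen j .S2

/-- The differential of the second generator of a pair. -/
noncomputable def botDiff (j : Fin k) : Pair → SortedAlg k
  | .A03 => botGen j .A01 * botGen j .A13 + botGen j .A02 * botGen j .A23
  | .B03 => botGen j .A01 * botGen j .B13 + botGen j .A02 * botGen j .B23 +
      botGen j .B01 * botGen j .A13 +
      botGen j .B02 * botGen j .A23
  | .T => botGen j .M + botGen j .B13 + xGen j * botGen j .B23
  | _ => 0

variable (k)

/-- The stabilized model. -/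
noncomputable def stableModel : BasedAlg :=
  (model k).stabilizeFamily (fun p : Fin k × Pair => p.2.deg)

/-- The cellular algebra with sorted generators. -/
noncomputable def sorted : BasedAlg where
  Gen := SortedGen k
  deg := (stableModel k).deg
  dGen
    | .old (.x _) => 0
    | .old (.y _) => 0
    | .old .z => ∑ j, (botGen j .S1 + botGen j .S2)
    | .top (j, i) => botGen j i + remainder j i
    | .bot (j, i) => botDiff j i

/-- Lets entries be read off at numerals of `Fin 4` or `Fin 2` although the matrices are indexed by
the sheets of a cell. -/
theorem entry_eq {n : ℕ} {R : Type*} {M N : Matrix (Fin n) (Fin n) R} (h : M = N) (p q : Fin n) :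
    M p q = N p q := by
  rw [h]

theorem sorted_relabelIso [NeZero k] : RelabelIso (sorted k) (front k).cellularDGA := by
  have ht : ∀ j i, FreeAlgebra.lift (ZMod 2)
      (fun g => FreeAlgebra.ι (ZMod 2) (toGen k g)) (topGen j i) = top j i :=
    fun j i => FreeAlgebra.lift_ι_apply _ _
  have hb : ∀ j i, FreeAlgebra.lift (ZMod 2)
      (fun g => FreeAlgebra.ι (ZMod 2) (toGen k g)) (botGen j i) = bot j i :=
    fun j i => FreeAlgebra.lift_ι_apply _ _
  have hx : ∀ j, FreeAlgebra.lift (ZMod 2)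
      (fun g => FreeAlgebra.ι (ZMod 2) (toGen k g)) (xGen j) = genX j :=
    fun j => FreeAlgebra.lift_ι_apply _ _
  have hy : ∀ j, FreeAlgebra.lift (ZMod 2)
      (fun g => FreeAlgebra.ι (ZMod 2) (toGen k g)) (yGen j) = genY j :=
    fun j => FreeAlgebra.lift_ι_apply _ _
  refine ⟨genEquiv k, ?_, ?_⟩
  · rintro ((j | j | _) | ⟨j, i⟩ | ⟨j, i⟩)
    · rfl
    · rfl
    · rfl
    · cases i <;> rfl
    · cases i <;> rfl
  · intro g
    change FreeAlgebra.lift (ZMod 2) (fun g => FreeAlgebra.ι (ZMod 2) (toGen k g)) _ =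
      (front k).dMat (toGen k g).cell (toGen k g).p (toGen k g).q
    rcases g with (j | j | _) | ⟨j, i⟩ | ⟨j, i⟩
    · exact (map_zero _).trans (entry_eq (n := 4) (dMat_B4_eq j) 1 2).symm
    · exact (map_zero _).trans (entry_eq (n := 4) (dMat_C3_eq j) 1 2).symm
    · refine Eq.trans ?_ (entry_eq (n := 2) (dMat_C1_eq (k := k)) 0 1).symm
      simp only [sorted, map_sum, map_add, hb]
      rfl
    · have hB4 := fun p q : Fin 4 => entry_eq (dMat_B4_eq j) p q
      have hC3 := fun p q : Fin 4 => entry_eq (dMat_C3_eq j) p q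
      have hC2 := fun p q : Fin 4 => entry_eq (dMat_C2_eq j) p q
      cases i <;> simp only [sorted, remainder, map_add, map_mul, map_one, map_zero, ht, hb, hx, hy]
      · exact (hB4 0 1).symm
      · exact (hB4 0 2).symm
      · refine Eq.trans ?_ (hB4 0 3).symm
        simp [strictUpper, add_assoc]
      · exact (hB4 1 3).symm
      · exact (hB4 2 3).symm
      · exact (hC3 0 2).symm
      · exact (add_zero _).trans (hC3 0 1).symm
      · refine Eq.trans ?_ (hC3 0 3).symm
        simp [strictUpper, add_assoc]
      · exact (add_zero _).trans (hC3 2 3).symm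
      · exact (hC3 1 3).symm
      · exact (hC2 0 1).symm
      · exact (hC2 2 3).symm
      · exact (hC2 0 2).symm
      · refine Eq.trans ?_ (hC2 0 3).symm
        simp [strictUpper, add_assoc]
    · have hA := fun p q : Fin 4 => entry_eq (dMat_A_eq j) p q
      have hB3 := fun p q : Fin 4 => entry_eq (dMat_B3_eq j) p q
      have hC2 := fun p q : Fin 4 => entry_eq (dMat_C2_eq j) p q
      cases i <;> simp only [sorted, botDiff, map_add, map_mul, map_zero, hb, hx]
      · exact (hA 0 1).symm
      · exact (hA 0 2).symm
      · exact (hA 0 3).symm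
      · exact (hA 1 3).symm
      · exact (hA 2 3).symm
      · exact (hB3 0 1).symm
      · exact (hB3 0 2).symm
      · exact (hB3 0 3).symm
      · exact (hB3 1 3).symm
      · exact (hB3 2 3).symm
      · exact (entry_eq (n := 2) (dMat_B1 j) 0 1).symm
      · exact (entry_eq (n := 2) (dMat_B2 j) 0 1).symm
      · exact (hC2 1 2).symm
      · refine Eq.trans ?_ (hC2 1 3).symm
        simp [strictUpper, add_assoc]

/-! ### The tame isomorphism to the stabilized model -/

/-- A filtration of the generators. -/
def rank : SortedGen k → ℕ
  | .old .z => 1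
  | .old _ => 0
  | .top _ => 0
  | .bot (_, .A02) => 2
  | .bot (_, .A03) => 3
  | .bot (_, .B01) => 3
  | .bot (_, .B03) => 4
  | .bot (_, .B23) => 2
  | .bot (_, .S1) => 5
  | .bot (_, .S2) => 5
  | .bot (_, .M) => 5
  | .bot (_, .T) => 6
  | .bot _ => 1

/-- The substitution that simplifies the differential. -/
noncomputable def correction : SortedGen k → SortedAlg k
  -- In the model, the differential of this sum consists of the terms of φ(bot S1) + φ(bot S2) other
  -- than xy + yx. Those terms arise by expanding S1 → B01 → A02 y and S2 → B23 → y A13.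
  | .old .z => ∑ j, (topGen j .S1 + topGen j .B01 + topGen j .A02 * yGen j +
      topGen j .A01 * xGen j * yGen j +
      topGen j .S2 + topGen j .B23 + yGen j * topGen j .A13)
  | .old _ => 0
  | .top _ => 0
  | .bot (j, i) => remainder j i

instance : Finite (ModelGen k) := by
  have : Function.Surjective (fun g : Fin k ⊕ Fin k ⊕ Unit =>
      match g with
      | .inl j => ModelGen.x j
      | .inr (.inl j) => .y j
      | .inr (.inr _) => .z) := by
    rintro (j | j | _)
    · exact ⟨.inl j, rfl⟩
    · exact ⟨.inr (.inl j), rfl⟩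
    · exact ⟨.inr (.inr ()), rfl⟩
  exact Finite.of_surjective _ this

theorem correction_mem_adjoin (g : SortedGen k) : correction k g ∈
    Algebra.adjoin (ZMod 2) (FreeAlgebra.ι (ZMod 2) '' {h | rank k h < rank k g}) := by
  have hmem : ∀ h : SortedGen k, rank k h < rank k g → FreeAlgebra.ι (ZMod 2) h ∈
      Algebra.adjoin (ZMod 2) (FreeAlgebra.ι (ZMod 2) '' {h | rank k h < rank k g}) :=
    fun h hh => Algebra.subset_adjoin ⟨h, hh, rfl⟩
  rcases g with (j | j | _) | ⟨j, i⟩ | ⟨j, i⟩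
  · exact zero_mem _
  · exact zero_mem _
  · refine sum_mem fun j _ => ?_
    repeat' first | apply add_mem | apply mul_mem
    all_goals exact hmem _ Nat.zero_lt_one
  · exact zero_mem _
  · cases i <;> simp only [correction, remainder]
    all_goals repeat' first | exact zero_mem _ | exact one_mem _ | apply add_mem | apply mul_mem
    -- Ranks are numerals, so each inequality holds by evaluating the difference.
    all_goals exact hmem _ (Nat.lt_of_sub_eq_succ rfl)

theorem correction_mem_homogeneous (g : SortedGen k) :
    correction k g ∈ (sorted k).homogeneous ((sorted k).deg g) := by
  have ht : ∀ j i, topGen j i ∈ (sorted k).homogeneous (Pair.deg i) :=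
    fun j i => (sorted k).gen_mem_homogeneous (.top (j, i))
  have hb : ∀ j i, botGen j i ∈ (sorted k).homogeneous (Pair.deg i - 1) :=
    fun j i => (sorted k).gen_mem_homogeneous (.bot (j, i))
  have hx : ∀ j, xGen j ∈ (sorted k).homogeneous (-1) :=
    fun j => (sorted k).gen_mem_homogeneous (.old (.x j))
  have hy : ∀ j, yGen j ∈ (sorted k).homogeneous 2 :=
    fun j => (sorted k).gen_mem_homogeneous (.old (.y j))
  have hcast : ∀ {a : SortedAlg k} {m n : ℤ}, a ∈ (sorted k).homogeneous m → m = n →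
      a ∈ (sorted k).homogeneous n := fun h e => e ▸ h
  rcases g with (j | j | _) | ⟨j, i⟩ | ⟨j, i⟩
  · exact zero_mem _
  · exact zero_mem _
  · refine sum_mem fun j _ => ?_
    repeat' apply add_mem
    all_goals
      -- This leaves the degree open: it is assembled from the factors, and the resulting equation
      -- of integers holds by evaluation.
      apply hcast
      · repeat' first
          | apply ht
          | apply hb
          | apply hx
          | apply hy
          | apply (sorted k).mul_mem_homogeneous
      · rfl
  · exact zero_mem _
  · cases i <;> simp only [correction, remainder]
    all_goals repeat' first | exact zero_mem _ | apply add_mem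
    all_goals
      apply hcast
      · repeat' first
          | apply ht
          | apply hb
          | apply hx
          | apply hy
          | exact (sorted k).one_mem_homogeneous
          | apply (sorted k).mul_mem_homogeneous
      · rfl

theorem sorted_tameIso : TameIso (sorted k) (stableModel k) := by
  have : Finite (sorted k).Gen := inferInstanceAs (Finite (SortedGen k))
  obtain ⟨φ, hφ, h⟩ := exists_tame_of_triangular (sorted k) (rank k) (correction k)
    (correction_mem_adjoin k) (correction_mem_homogeneous k)
  -- The two algebras have the same generators and degrees by construction and differ only in the
  -- differential.
  refine ⟨φ, hφ, Equiv.refl _, fun _ => rfl, fun a => ?_⟩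
  refine (lift_gen_eq_self (G := SortedGen k) _).trans
    (Eq.trans ?_ (congrArg (stableModel k).diff (lift_gen_eq_self (G := SortedGen k) _).symm))
  refine map_diff (X := sorted k) (Y := stableModel k) φ (fun g => ?_) a
  -- `f` and `d` are opaque copies of φ and of the model differential, both acting on the one
  -- algebra `SortedAlg k`, known only through their values below.
  obtain ⟨f, hf⟩ : ∃ f : SortedAlg k →ₐ[ZMod 2] SortedAlg k, f = φ := ⟨φ, rfl⟩
  obtain ⟨d, hd⟩ : ∃ d : SortedAlg k →ₗ[ZMod 2] SortedAlg k, d = (stableModel k).diff := ⟨_, rfl⟩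
  have hfx : ∀ j, f (xGen j) = xGen j := fun j => by
    rw [hf]
    exact (h (.old (.x j))).trans ((congrArg _ (map_zero φ)).trans (add_zero _))
  have hfy : ∀ j, f (yGen j) = yGen j := fun j => by
    rw [hf]
    exact (h (.old (.y j))).trans ((congrArg _ (map_zero φ)).trans (add_zero _))
  have hft : ∀ j i, f (topGen j i) = topGen j i := fun j i => by
    rw [hf]
    exact (h (.top (j, i))).trans ((congrArg _ (map_zero φ)).trans (add_zero _))
  have hfb : ∀ j i, f (botGen j i) = botGen j i + f (remainder j i) := fun j i => by
    rw [hf]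
    exact h (.bot (j, i))
  have hfz : f zGen = zGen + f (correction k (.old .z)) := by
    rw [hf]
    exact h (.old .z)
  have hdx : ∀ j, d (xGen j) = 0 := fun j => by
    rw [hd]
    exact ((stableModel k).diff_gen (.old (.x j))).trans (map_zero _)
  have hdy : ∀ j, d (yGen j) = 0 := fun j => by
    rw [hd]
    exact ((stableModel k).diff_gen (.old (.y j))).trans (map_zero _)
  have hdt : ∀ j i, d (topGen j i) = botGen j i := fun j i => by
    rw [hd]
    exact (stableModel k).diff_gen (.top (j, i))
  have hdb : ∀ j i, d (botGen j i) = 0 := fun j i => by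
    rw [hd]
    exact (stableModel k).diff_gen (.bot (j, i))
  have hdz : d zGen = ∑ j, (xGen j * yGen j + yGen j * xGen j) := by
    rw [hd]
    refine ((stableModel k).diff_gen (.old .z)).trans ?_
    change FreeAlgebra.lift (ZMod 2)
      (fun h : ModelGen k => (FreeAlgebra.ι (ZMod 2) (FamilyGen.old h) : SortedAlg k))
      (∑ j : Fin k,
        (FreeAlgebra.ι (ZMod 2) (ModelGen.x j) * FreeAlgebra.ι (ZMod 2) (ModelGen.y j) +
        FreeAlgebra.ι (ZMod 2) (ModelGen.y j) * FreeAlgebra.ι (ZMod 2) (ModelGen.x j))) = _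
    simp only [map_sum, map_add, map_mul, FreeAlgebra.lift_ι_apply]
    rfl
  have hdm : ∀ a b, d (a * b) = d a * b + a * d b := fun a b => by
    rw [hd]
    exact (stableModel k).diff_mul a b
  have hd1 : d 1 = 0 := by
    rw [hd]
    exact (stableModel k).diff_one
  change φ _ = (stableModel k).diff _
  rw [← hf, ← hd]
  clear hd hf h hφ
  rcases g with (j | j | _) | ⟨j, i⟩ | ⟨j, i⟩
  · change f 0 = d (f (xGen j))
    rw [hfx, hdx, map_zero]
  · change f 0 = d (f (yGen j))
    rw [hfy, hdy, map_zero]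
  · change f (∑ j, (botGen j .S1 + botGen j .S2)) = d (f zGen)
    rw [hfz, correction, map_add, hdz, map_sum, map_sum, map_sum, ← Finset.sum_add_distrib]
    refine Finset.sum_congr rfl fun j _ => ?_
    simp only [hfb, remainder, map_add, map_mul, map_one, hft, hfx, hfy, hdt, hdx, hdy, hdm]
    grind
  · change f (botGen j i + remainder j i) = d (f (topGen j i))
    -- The image of the remainder appears twice, once through the image of bot, and cancels.
    rw [map_add, hfb, hft, hdt, add_assoc, CharTwo.add_self_eq_zero, add_zero]
  · change f (botDiff j i) = d (f (botGen j i))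
    rw [hfb, map_add, hdb, zero_add]
    -- The triangular system is solved explicitly, in order of rank, where the values themselves are
    -- needed.
    have hA01 : f (botGen j .A01) = botGen j .A01 + 1 := by rw [hfb, remainder, map_one]
    have hA13 : f (botGen j .A13) = botGen j .A13 + xGen j := by rw [hfb, remainder, hfx]
    have hA23 : f (botGen j .A23) = botGen j .A23 + 1 := by rw [hfb, remainder, map_one]
    have hA02 : f (botGen j .A02) = botGen j .A02 + (botGen j .A01 + 1) * xGen j := by
      rw [hfb, remainder, map_mul, hA01, hfx]
    have hB01 : f (botGen j .B01) = botGen j .B01 + (botGen j .A02 + (botGen j .A01 +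
        1) * xGen j) * yGen j := by
      rw [hfb, remainder, map_mul, hA02, hfy]
    have hB02 : f (botGen j .B02) = botGen j .B02 := by
      rw [hfb, remainder, map_zero, add_zero]
    have hB13 : f (botGen j .B13) = botGen j .B13 := by
      rw [hfb, remainder, map_zero, add_zero]
    have hB23 : f (botGen j .B23) = botGen j .B23 + yGen j * (botGen j .A13 + xGen j) := by
      rw [hfb, remainder, map_mul, hA13, hfy]
    have hM : f (botGen j .M) = botGen j .M + (botGen j .B02 +
        (botGen j .B01 + (botGen j .A02 + (botGen j .A01 + 1) * xGen j) * yGen j) * xGen j) := by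
      rw [hfb, remainder, map_add, map_mul, hB02, hB01, hfx]
    have hS2 : f (botGen j .S2) = botGen j .S2 + (botGen j .B23 + yGen j * (botGen j .A13 +
        xGen j)) := by
      rw [hfb, remainder, hB23]
    -- B03 occurs in the remainder of T, where only the differential of its image matters; the image
    -- itself stays unexpanded.
    have hdB03 : d (f (botGen j .B03)) = f (botDiff j .B03) := by
      rw [hfb, map_add, hdb, zero_add]
      simp only [botDiff, remainder, map_add, map_mul, hft, hA01, hA13, hA23, hA02, hB01, hB02,
        hB13, hB23, hd1, hdx, hdt, hdb, hdm]
      clear * -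
      grind
    cases i <;> simp only [botDiff, remainder, map_zero, map_one, map_add, map_mul, hft, hfx, hfy,
      hA01, hA13, hA23, hA02, hB01, hB02, hB13, hB23, hM, hS2, hdB03, hd1, hdx, hdy, hdt, hdb, hdm]
    all_goals
      clear * -
      grind

end sorted

/-! ### The small model is a differential graded algebra; conclusion. -/

theorem model_dGen_z_mem_homogeneous (k : ℕ) :
    (model k).dGen .z ∈ (model k).homogeneous 1 := by
  have hx : ∀ j, (model k).gen (.x j) ∈ (model k).homogeneous (-1) :=
    fun j => (model k).gen_mem_homogeneous (.x j)
  have hy : ∀ j, (model k).gen (.y j) ∈ (model k).homogeneous 2 :=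
    fun j => (model k).gen_mem_homogeneous (.y j)
  have hz : (model k).dGen .z = ∑ j : Fin k, ((model k).gen (.x j) * (model k).gen (.y j) +
      (model k).gen (.y j) * (model k).gen (.x j)) := rfl
  rw [hz]
  refine Submodule.sum_mem _ fun j _ => Submodule.add_mem _ ?_ ?_
  · have h := (model k).mul_mem_homogeneous (hx j) (hy j)
    rwa [show (-1 : ℤ) + 2 = 1 by norm_num] at h
  · have h := (model k).mul_mem_homogeneous (hy j) (hx j)
    rwa [show (2 : ℤ) + -1 = 1 by norm_num] at h

theorem model_diff_dGen_z (k : ℕ) : (model k).diff ((model k).dGen .z) = 0 := by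
  have hdx : ∀ j, (model k).diff ((model k).gen (.x j)) = 0 := fun j => (model k).diff_gen (.x j)
  have hdy : ∀ j, (model k).diff ((model k).gen (.y j)) = 0 := fun j => (model k).diff_gen (.y j)
  have hz : (model k).dGen .z = ∑ j : Fin k, ((model k).gen (.x j) * (model k).gen (.y j) +
      (model k).gen (.y j) * (model k).gen (.x j)) := rfl
  rw [hz, map_sum]
  refine Finset.sum_eq_zero fun j _ => ?_
  rw [map_add, diff_mul, diff_mul, hdx, hdy]
  simp

theorem model_isDGA (k : ℕ) : (model k).IsDGA := by
  have : Finite (model k).Gen := inferInstanceAs (Finite (ModelGen k))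
  refine isDGA_of_gen _ ?_ ?_
  · rintro (j | j | _)
    · exact zero_mem _
    · exact zero_mem _
    · exact model_dGen_z_mem_homogeneous k
  · rintro (j | j | _)
    · exact map_zero _
    · exact map_zero _
    · exact model_diff_dGen_z k

theorem front_tameIso_stableModel (k : ℕ) [NeZero k] :
    TameIso (front k).cellularDGA (stableModel k) :=
  (sorted_relabelIso k).symm.trans_tameIso (sorted_tameIso k)

theorem front_stableTameIso (k : ℕ) [NeZero k] :
    StableTameIso (front k).cellularDGA (model k) := by
  obtain ⟨l, hl⟩ := exists_relabelIso_stabilizeList (Fin k × Pair) (model k) (fun p => p.2.deg)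
  -- Only the model has to be stabilized, once for each cancelling pair.
  exact ⟨[], l, (front_tameIso_stableModel k).trans_relabelIso hl⟩

end Lk

theorem proposition5 (k : ℕ) [NeZero k] :
    (Lk.front k).cellularDGA.IsDGA ∧ (Lk.model k).IsDGA ∧
    BasedAlg.StableTameIso (Lk.front k).cellularDGA (Lk.model k) ∧
    ∀ (L : Set Jet) (E : CompatibleDecomposition (Lk.front k) L),
      BasedAlg.StableTameIso E.cellularDGA (Lk.model k) :=
  -- The algebra of a compatible decomposition is defined from the combinatorial data alone, so the
  -- last two claims have the same proof.
  ⟨(Lk.front_tameIso_stableModel k).isDGA ((Lk.model_isDGA k).stabilizeFamily _),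
    Lk.model_isDGA k, Lk.front_stableTameIso k, fun _ _ => Lk.front_stableTameIso k⟩
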